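/- Let $\mathfrak{sl}_2$ be the complex Lie algebra with basis $e,h,f$ and $[e,f]=h$, $[h,e]=2e$, $[h,f]=-2f$, let $D=\mathbb{C}[\varepsilon]/(\varepsilon^2)$, and let $\mathfrak{g}=\mathfrak{sl}_2\otimes_{\mathbb{C}}D$ be the Takiff Lie algebra, with bracket $[a\otimes s,b\otimes t]=[a,b]\otimes st$. Write $\overline{a}=a\otimes\varepsilon$ for $a\in\mathfrak{sl}_2$. Let $\overline{\mathfrak{h}}$ be the subalgebra generated by $h,\overline{h}$, let $\overline{\mathfrak{n}}_+$ be the subalgebra generated by $e,\overline{e}$, and let $\overline{\mathfrak{b}}=\overline{\mathfrak{h}}\oplus\overline{\mathfrak{n}}_+$. Let $\widetilde{\mathcal{O}}$ be the category of finitely generated $\mathfrak{g}$-modules on which $U(\overline{\mathfrak{b}})$ acts locally finitely, and let $\mathcal{O}$ be its full subcategory of modules on which $h$ acts diagonalizably. For $\lambda\in\overline{\mathfrak{h}}^*$, let $\mathbf{m}_\lambda\subset U(\overline{\mathfrak{h}})$ be the corresponding maximal ideal, and for a $\mathfrak{g}$-module $M$ let $M^\lambda$ be the $U(\overline{\mathfrak{h}})$-module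 of all vectors in $M$ killed by some power of $\mathbf{m}_\lambda$. Let $L(\lambda)$ be the unique simple quotient of the Verma module $\Delta(\lambda)=U(\mathfrak{g})\otimes_{U(\overline{\mathfrak{b}})}\mathbb{C}_\lambda$, where $\mathbb{C}_\lambda$ is the one-dimensional $\overline{\mathfrak{b}}$-module on which $\overline{\mathfrak{h}}$ acts by $\lambda$ and $\overline{\mathfrak{n}}_+$ by zero. Suppose that $\lambda(\overline{h})\neq 0$. For $\mathcal{X}\in\{\mathcal{O},\widetilde{\mathcal{O}}\}$, let $\mathcal{X}(\lambda)$ be the corresponding block, that is, the full subcategory of $\mathcal{X}$ consisting of all modules whose simple subquotients are all isomorphic to $L(\lambda)$. Then: (a) The block $\mathcal{O}(\lambda)$ is equivalent to the category of $\mathbb{C}[[x]]$-modules that are finite-dimensional over $\mathbb{C}$. (b) The block $\widetilde{\mathcal{O}}(\lambda)$ is equivalent to the category of $\mathbb{C}[[x,y]]$-modules that are finite-dimensional over $\mathbb{C}$. Moreover, the equivalences can be chosen as follows, up to natural isomorphism. The functor from the block sends $M$ to $M^\lambda$, on which $x$ acts as $\overline{h}-\lambda(\overline{h})$ and, in (b),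 $y$ acts as $h-\lambda(h)$. Its quasi-inverse is parabolic induction $V\mapsto U(\mathfrak{g})\otimes_{U(\overline{\mathfrak{b}})}V$, where $\overline{\mathfrak{n}}_+$ acts on $V$ by zero, $\overline{h}$ acts by $\lambda(\overline{h})+x$, and $h$ acts by $\lambda(h)$ in (a) and by $\lambda(h)+y$ in (b). -/

import Mathlib

open CategoryTheory TensorProduct

open scoped ModuleCat.Algebra

noncomputable section

namespace TakiffSl2

attribute [local instance 100] LieRing.ofAssociativeRing

/-! ### The Takiff Lie algebra of `sl₂` -/

/-- The Lie algebra `sl₂(ℂ)` of traceless `2 × 2` matrices. -/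
def Sl2 : Type := LieAlgebra.SpecialLinear.sl (Fin 2) ℂ

instance : LieRing Sl2 := inferInstanceAs (LieRing (LieAlgebra.SpecialLinear.sl (Fin 2) ℂ))

instance : LieAlgebra ℂ Sl2 :=
  inferInstanceAs (LieAlgebra ℂ (LieAlgebra.SpecialLinear.sl (Fin 2) ℂ))

/-- The standard basis vector `e` of `sl₂`. -/
def sl2e : Sl2 := LieAlgebra.SpecialLinear.single 0 1 (by decide) (1 : ℂ)

/-- The standard basis vector `f` of `sl₂`. -/
def sl2f : Sl2 := LieAlgebra.SpecialLinear.single 1 0 (by decide) (1 : ℂ)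

/-- The standard basis vector `h` of `sl₂`. -/
def sl2h : Sl2 := LieAlgebra.SpecialLinear.singleSubSingle 0 1 (1 : ℂ)

/-- The Takiff Lie algebra `𝔤 = D ⊗ sl₂` over `ℂ`, where `D = ℂ[ε]/(ε²)`, with the bracket
`[s ⊗ a, t ⊗ b] = st ⊗ [a, b]`. -/
def Takiff : Type := DualNumber ℂ ⊗[ℂ] Sl2

instance : LieRing Takiff := inferInstanceAs (LieRing (DualNumber ℂ ⊗[ℂ] Sl2))

instance : LieAlgebra ℂ Takiff := inferInstanceAs (LieAlgebra ℂ (DualNumber ℂ ⊗[ℂ] Sl2))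

/-- The element `a ⊗ s` of `𝔤`, as a linear function of `a ∈ sl₂`. -/
def tens (s : DualNumber ℂ) : Sl2 →ₗ[ℂ] Takiff := TensorProduct.mk ℂ (DualNumber ℂ) Sl2 s

lemma tens_lie_tens (s t : DualNumber ℂ) (a b : Sl2) :
    ⁅tens s a, tens t b⁆ = tens (s * t) ⁅a, b⁆ :=
  LieAlgebra.ExtendScalars.bracket_tmul ℂ (DualNumber ℂ) Sl2 Sl2 s t a b

/-- `e`, as an element of `𝔤`. -/
def e : Takiff := tens 1 sl2e

/-- `f`, as an element of `𝔤`. -/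
def f : Takiff := tens 1 sl2f

/-- `h`, as an element of `𝔤`. -/
def h : Takiff := tens 1 sl2h

/-- `ē = e ⊗ ε`. -/
def eBar : Takiff := tens DualNumber.eps sl2e

/-- `f̄ = f ⊗ ε`. -/
def fBar : Takiff := tens DualNumber.eps sl2f

/-- `h̄ = h ⊗ ε`. -/
def hBar : Takiff := tens DualNumber.eps sl2h

/-- The Cartan subalgebra of `𝔤`, generated by `h` and `h̄`. -/
def cartan : LieSubalgebra ℂ Takiff := LieSubalgebra.lieSpan ℂ Takiff {h, hBar}

/-- The subalgebra of `𝔤` generated by `e` and `ē`. -/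
def nPlus : LieSubalgebra ℂ Takiff := LieSubalgebra.lieSpan ℂ Takiff {e, eBar}

/-- The Borel subalgebra `b̄ = h̄ ⊕ n̄₊` of `𝔤`. -/
def borel : LieSubalgebra ℂ Takiff := cartan ⊔ nPlus

lemma cartan_le_borel : cartan ≤ borel := le_sup_left

lemma h_mem_cartan : h ∈ cartan := LieSubalgebra.subset_lieSpan (by simp)

lemma hBar_mem_cartan : hBar ∈ cartan := LieSubalgebra.subset_lieSpan (by simp)

/-- `h`, as an element of the Cartan subalgebra. -/
def hC : cartan := ⟨h, h_mem_cartan⟩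

/-- `h̄`, as an element of the Cartan subalgebra. -/
def hBarC : cartan := ⟨hBar, hBar_mem_cartan⟩

/-- The upper left matrix entry, i.e. the coefficient of `h` in the basis `e, h, f` of `sl₂`. -/
def sl2Coord : Sl2 →ₗ[ℂ] ℂ :=
  Matrix.entryLinearMap ℂ ℂ 0 0 ∘ₗ
    (LieAlgebra.SpecialLinear.sl (Fin 2) ℂ : Submodule ℂ (Matrix (Fin 2) (Fin 2) ℂ)).subtype

/-- The linear form `s ⊗ a ↦ l(s) c(a)` on `𝔤`, where `c(a)` is the coefficient of `h` in `a`. -/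
def coord (l : DualNumber ℂ →ₗ[ℂ] ℂ) : Takiff →ₗ[ℂ] ℂ :=
  (TensorProduct.lid ℂ ℂ).toLinearMap ∘ₗ TensorProduct.map l sl2Coord

/-- The coefficient of `h` in the basis `e, h, f, ē, h̄, f̄` of `𝔤`. -/
def coordH : Takiff →ₗ[ℂ] ℂ := coord (TrivSqZeroExt.fstHom ℂ ℂ ℂ).toLinearMap

/-- The coefficient of `h̄` in the basis `e, h, f, ē, h̄, f̄` of `𝔤`. -/
def coordHBar : Takiff →ₗ[ℂ] ℂ := coord (TrivSqZeroExt.sndHom ℂ ℂ)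

lemma coord_tens (l : DualNumber ℂ →ₗ[ℂ] ℂ) (s : DualNumber ℂ) (a : Sl2) :
    coord l (tens s a) = l s * sl2Coord a := by
  change TensorProduct.lid ℂ ℂ (TensorProduct.map l sl2Coord (s ⊗ₜ a)) = _
  simp

/-- The projection of `𝔤` onto the Cartan subalgebra along the span of `e, f, ē, f̄`. -/
def proj : Takiff →ₗ[ℂ] cartan :=
  coordH.smulRight hC + coordHBar.smulRight hBarC

lemma sl2h_lie_sl2e : ⁅sl2h, sl2e⁆ = (2 : ℂ) • sl2e := by
  refine Subtype.ext ?_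
  refine (LieAlgebra.SpecialLinear.sl_bracket (n := Fin 2) (R := ℂ) sl2h sl2e).trans ?_
  change (sl2h.val * sl2e.val - sl2e.val * sl2h.val : Matrix (Fin 2) (Fin 2) ℂ) =
    (2 : ℂ) • (sl2e.val : Matrix (Fin 2) (Fin 2) ℂ)
  have h1 : (sl2h.val : Matrix (Fin 2) (Fin 2) ℂ) = !![1, 0; 0, -1] := by
    ext i j
    fin_cases i <;> fin_cases j <;> simp [sl2h, Matrix.single]
  have h2 : (sl2e.val : Matrix (Fin 2) (Fin 2) ℂ) = !![0, 1; 0, 0] := by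
    ext i j
    fin_cases i <;> fin_cases j <;> simp [sl2e, Matrix.single]
  rw [h1, h2]
  ext i j
  fin_cases i <;> fin_cases j <;> simp
  norm_num

lemma sl2e_lie_sl2h : ⁅sl2e, sl2h⁆ = (-2 : ℂ) • sl2e := by
  rw [← lie_skew, sl2h_lie_sl2e, neg_smul]

lemma tens_zero (a : Sl2) : tens 0 a = 0 := TensorProduct.zero_tmul _ _

lemma eps_mul_eps : (DualNumber.eps * DualNumber.eps : DualNumber ℂ) = 0 :=
  DualNumber.eps_mul_eps

lemma lie_mem_span {x y : Takiff} (hx : x ∈ Submodule.span ℂ ({h, hBar, e, eBar} : Set Takiff))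
    (hy : y ∈ Submodule.span ℂ ({h, hBar, e, eBar} : Set Takiff)) :
    ⁅x, y⁆ ∈ Submodule.span ℂ ({e, eBar} : Set Takiff) := by
  have he : e ∈ Submodule.span ℂ ({e, eBar} : Set Takiff) := Submodule.subset_span (by simp)
  have heb : eBar ∈ Submodule.span ℂ ({e, eBar} : Set Takiff) := Submodule.subset_span (by simp)
  induction hx, hy using Submodule.span_induction₂ with
  | mem_mem x y hx hy =>
    simp only [Set.mem_insert_iff, Set.mem_singleton_iff] at hx hy
    have h1 := Submodule.smul_mem _ (2 : ℂ) he
    have h2 := Submodule.smul_mem _ (2 : ℂ) heb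
    have h3 := Submodule.smul_mem _ (-2 : ℂ) he
    have h4 := Submodule.smul_mem _ (-2 : ℂ) heb
    rcases hx with rfl | rfl | rfl | rfl <;> rcases hy with rfl | rfl | rfl | rfl <;>
      simp only [e, h, eBar, hBar, tens_lie_tens, lie_self,
        sl2h_lie_sl2e, sl2e_lie_sl2h, eps_mul_eps, map_zero,
        tens_zero, map_smul, mul_one, one_mul] at * <;>
      first | exact Submodule.zero_mem _ | assumption
  | zero_left y _ => simp
  | zero_right x _ => simp
  | add_left x y z _ _ _ h1 h2 => rw [add_lie]; exact add_mem h1 h2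
  | add_right x y z _ _ _ h1 h2 => rw [lie_add]; exact add_mem h1 h2
  | smul_left r x y _ _ h1 => rw [smul_lie]; exact Submodule.smul_mem _ _ h1
  | smul_right r x y _ _ h1 => rw [lie_smul]; exact Submodule.smul_mem _ _ h1

lemma borel_le_span (x : Takiff) (hx : x ∈ borel) :
    x ∈ Submodule.span ℂ ({h, hBar, e, eBar} : Set Takiff) := by
  let K : LieSubalgebra ℂ Takiff :=
    { Submodule.span ℂ ({h, hBar, e, eBar} : Set Takiff) with
      lie_mem' := fun hx hy => Submodule.span_mono (by
        intro z hz
        simp only [Set.mem_insert_iff, Set.mem_singleton_iff] at hz ⊢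
        tauto) (lie_mem_span hx hy) }
  have hK : borel ≤ K := by
    refine sup_le (LieSubalgebra.lieSpan_le.2 ?_) (LieSubalgebra.lieSpan_le.2 ?_)
    all_goals
      intro z hz
      refine Submodule.subset_span ?_
      simp only [Set.mem_insert_iff, Set.mem_singleton_iff] at hz ⊢
      tauto
  exact hK hx

lemma sl2Coord_sl2e : sl2Coord sl2e = 0 := by
  change (sl2e.val : Matrix (Fin 2) (Fin 2) ℂ) 0 0 = 0
  simp [sl2e]

lemma sl2Coord_sl2h : sl2Coord sl2h = 1 := by
  change (sl2h.val : Matrix (Fin 2) (Fin 2) ℂ) 0 0 = 1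
  simp [sl2h]

lemma proj_h : proj h = hC := by
  simp [proj, coordH, coordHBar, h, coord_tens, sl2Coord_sl2h]

lemma proj_hBar : proj hBar = hBarC := by
  simp [proj, coordH, coordHBar, hBar, coord_tens, sl2Coord_sl2h]

lemma proj_e : proj e = 0 := by
  simp [proj, coordH, coordHBar, e, coord_tens, sl2Coord_sl2e]

lemma proj_eBar : proj eBar = 0 := by
  simp [proj, coordH, coordHBar, eBar, coord_tens, sl2Coord_sl2e]

lemma proj_lie (x y : Takiff) (hx : x ∈ borel) (hy : y ∈ borel) : proj ⁅x, y⁆ = 0 := by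
  have hle : Submodule.span ℂ ({e, eBar} : Set Takiff) ≤ LinearMap.ker proj := by
    refine Submodule.span_le.2 ?_
    rintro z (rfl | rfl)
    · exact proj_e
    · exact proj_eBar
  exact hle (lie_mem_span (borel_le_span x hx) (borel_le_span y hy))

lemma proj_of_mem (x : cartan) : proj x = x := by
  obtain ⟨x, hx⟩ := x
  have key : (proj x : Takiff) = x := by
    induction hx using LieSubalgebra.lieSpan_induction with
    | mem x hx =>
      rcases hx with rfl | rfl
      · rw [proj_h]; rfl
      · rw [proj_hBar]; rfl
    | zero => simp
    | add x y _ _ h1 h2 => simp [h1, h2]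
    | smul r x _ h1 => simp [h1]
    | lie x y hx hy h1 h2 =>
      have h0 : ⁅h, hBar⁆ = 0 := by simp [h, hBar, tens_lie_tens]
      have h0' : ⁅hBar, h⁆ = 0 := by simp [h, hBar, tens_lie_tens]
      have hz : ⁅x, y⁆ = 0 := by
        rw [← h1, ← h2]
        simp [proj, hC, hBarC, h0, h0']
      rw [hz]; simp
  exact Subtype.ext key

lemma cartan_lie (x y : cartan) : ⁅x, y⁆ = 0 := by
  rw [← proj_of_mem ⁅x, y⁆]
  exact proj_lie _ _ (cartan_le_borel x.2) (cartan_le_borel y.2)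

/-! ### Enveloping algebras and induction -/

/-- `U(𝔤)`. -/
abbrev U : Type := UniversalEnvelopingAlgebra ℂ Takiff

/-- `U(b̄)`. -/
abbrev UB : Type := UniversalEnvelopingAlgebra ℂ borel

/-- `U(h̄)`. -/
abbrev UH : Type := UniversalEnvelopingAlgebra ℂ cartan

/-- The canonical homomorphism `U(b̄) → U(𝔤)`. -/
def inclB : UB →ₐ[ℂ] U :=
  UniversalEnvelopingAlgebra.lift ℂ ((UniversalEnvelopingAlgebra.ι ℂ).comp borel.incl)

/-- The canonical homomorphism `U(h̄) → U(𝔤)`. -/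
def inclH : UH →ₐ[ℂ] U :=
  UniversalEnvelopingAlgebra.lift ℂ ((UniversalEnvelopingAlgebra.ι ℂ).comp cartan.incl)

section Induction

variable {A B : Type} [Ring A] [Ring B] (j : B →+* A)

/-- The relations `ab ⊗ v = a ⊗ bv` that define `A ⊗_B V` as a quotient of `A ⊗_ℤ V`. -/
def indRel (V : ModuleCat.{0} B) : Submodule A (A ⊗[ℤ] V) :=
  Submodule.span A {t | ∃ (a : A) (b : B) (v : V), t = (a * j b) ⊗ₜ[ℤ] v - a ⊗ₜ[ℤ] (b • v)}

/-- The induced module `A ⊗_B V`, for a homomorphism of (not necessarily commutative) rings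
`B → A`. -/
abbrev IndObj (V : ModuleCat.{0} B) : Type := (A ⊗[ℤ] V) ⧸ indRel j V

/-- The `A`-linear map `A ⊗_ℤ V → A ⊗_ℤ W` given by a `B`-linear map `V → W`. -/
def tensorMap {V W : ModuleCat.{0} B} (g : V ⟶ W) : A ⊗[ℤ] V →ₗ[A] A ⊗[ℤ] W :=
  TensorProduct.AlgebraTensorModule.map LinearMap.id g.hom.toAddMonoidHom.toIntLinearMap

lemma indRel_le {V W : ModuleCat.{0} B} (g : V ⟶ W) :
    indRel j V ≤ (indRel j W).comap (tensorMap g) := by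
  refine Submodule.span_le.2 ?_
  rintro _ ⟨a, b, v, rfl⟩
  refine Submodule.subset_span ⟨a, b, g.hom v, ?_⟩
  simp [tensorMap]

/-- Induction `A ⊗_B -` from `B`-modules to `A`-modules. -/
def ind : ModuleCat.{0} B ⥤ ModuleCat.{0} A where
  obj V := ModuleCat.of A (IndObj j V)
  map {V W} g := ModuleCat.ofHom ((indRel j V).mapQ (indRel j W) (tensorMap g) (indRel_le j g))
  map_id V := by
    refine ModuleCat.hom_ext (LinearMap.ext fun x => ?_)
    obtain ⟨z, rfl⟩ := Submodule.Quotient.mk_surjective _ x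
    · change Submodule.Quotient.mk (tensorMap (𝟙 V) z) = Submodule.Quotient.mk z
      congr 1
      induction z using TensorProduct.induction_on with
      | zero => simp
      | tmul a v => simp [tensorMap]
      | add z w hz hw => rw [map_add, hz, hw]
  map_comp {V W X} g g' := by
    refine ModuleCat.hom_ext (LinearMap.ext fun x => ?_)
    obtain ⟨z, rfl⟩ := Submodule.Quotient.mk_surjective _ x
    · change Submodule.Quotient.mk (tensorMap (g ≫ g') z) =
        Submodule.Quotient.mk (tensorMap g' (tensorMap g z))
      congr 1
      induction z using TensorProduct.induction_on with
      | zero => simp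
      | tmul a v => simp [tensorMap]
      | add z w hz hw => rw [map_add, map_add, map_add, hz, hw]

end Induction

section Characters

variable {R : Type} [CommRing R] [Algebra ℂ R] (φ : cartan →ₗ[ℂ] R)

/-- The homomorphism `U(h̄) → R` given by a linear map `φ : h̄ → R`, for a commutative algebra
`R`. -/
def cartanHom : UH →ₐ[ℂ] R :=
  UniversalEnvelopingAlgebra.lift ℂ
    { φ with
      map_lie' := by
        intro x y
        simp [cartan_lie, LieRing.of_associative_ring_bracket, mul_comm] }

/-- The homomorphism `U(b̄) → R` that extends `cartanHom φ` by zero on `n̄₊`. -/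
def borelHom : UB →ₐ[ℂ] R :=
  UniversalEnvelopingAlgebra.lift ℂ
    { φ ∘ₗ proj ∘ₗ borel.toSubmodule.subtype with
      map_lie' := by
        intro x y
        have := proj_lie x y x.2 y.2
        simp [this, LieRing.of_associative_ring_bracket, mul_comm] }

/-- Parabolic induction: an `R`-module is viewed as a `b̄`-module on which `z ∈ h̄` acts by `φ z`
and `n̄₊` acts by zero, and this module is induced to `𝔤`. -/
def parabolicInd : ModuleCat.{0} R ⥤ ModuleCat.{0} U :=
  ModuleCat.restrictScalars (borelHom φ).toRingHom ⋙ ind inclB.toRingHom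

end Characters

/-! ### Generalized weight spaces, Verma modules, categories `O` -/

/-- The dual `h̄*` of the Cartan subalgebra. -/
abbrev Weight : Type := Module.Dual ℂ cartan

/-- The maximal ideal `m_μ` of `U(h̄)`. -/
def maxIdeal (μ : Weight) : Ideal UH := RingHom.ker (cartanHom μ)

/-- The vectors of a `U(h̄)`-module killed by some power of `m_μ`. -/
def genWeightSpace (μ : Weight) (M : ModuleCat.{0} UH) : Submodule UH M where
  carrier := {v | ∃ k : ℕ, ∀ u ∈ maxIdeal μ ^ k, u • v = 0}
  zero_mem' := ⟨0, fun u _ => smul_zero u⟩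
  add_mem' := by
    rintro v w ⟨k, hk⟩ ⟨l, hl⟩
    refine ⟨k + l, fun u hu => ?_⟩
    rw [smul_add, hk u (Ideal.pow_le_pow_right (Nat.le_add_right k l) hu),
      hl u (Ideal.pow_le_pow_right (Nat.le_add_left l k) hu), add_zero]
  smul_mem' := by
    rintro w v ⟨k, hk⟩
    have : (maxIdeal μ).IsTwoSided := inferInstanceAs (RingHom.ker (cartanHom μ)).IsTwoSided
    refine ⟨k, fun u hu => ?_⟩
    rw [smul_smul]
    exact hk _ (Ideal.mul_mem_right _ _ hu)

/-- The functor `M ↦ M^μ` from `𝔤`-modules to `U(h̄)`-modules. -/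
def weightFunctor (μ : Weight) : ModuleCat.{0} U ⥤ ModuleCat.{0} UH where
  obj M := ModuleCat.of UH
    (genWeightSpace μ ((ModuleCat.restrictScalars inclH.toRingHom).obj M))
  map {M N} g := ModuleCat.ofHom
    (((ModuleCat.restrictScalars inclH.toRingHom).map g).hom.restrict (by
      rintro v ⟨k, hk⟩
      exact ⟨k, fun u hu => by rw [← map_smul, hk u hu, map_zero]⟩))
  map_id M := rfl
  map_comp g g' := rfl

/-- The Verma module `Δ(μ)`, induced from the one-dimensional `b̄`-module `ℂ_μ`. -/
def verma (μ : Weight) : ModuleCat.{0} U := (parabolicInd μ).obj (ModuleCat.of ℂ ℂ)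

/-- The simple module `L(μ)`: the quotient of `Δ(μ)` by the intersection of its maximal
submodules. -/
abbrev simpleL (μ : Weight) : Type := verma μ ⧸ Module.jacobson U (verma μ)

/-- The action of an algebra on a module is locally finite: every cyclic submodule is
finite-dimensional. -/
def LocallyFinite {A : Type} [Ring A] [Algebra ℂ A] (M : ModuleCat.{0} A) : Prop :=
  ∀ v : M, Module.Finite ℂ (ModuleCat.of A (Submodule.span A {v}))

/-- Thick category `O`: finitely generated `𝔤`-modules with a locally finite action of `U(b̄)`. -/
def thickO : ObjectProperty (ModuleCat.{0} U) := fun M =>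
  Module.Finite U M ∧ LocallyFinite ((ModuleCat.restrictScalars inclB.toRingHom).obj M)

/-- Classical category `O`: the modules in thick category `O` on which `h` acts diagonalizably. -/
def classicalO : ObjectProperty (ModuleCat.{0} U) := fun M =>
  thickO M ∧
    ⨆ c : ℂ, Module.End.eigenspace
      (Algebra.lsmul ℂ ℂ M (UniversalEnvelopingAlgebra.ι ℂ h : U)) c = ⊤

/-- The block of a category `X` of `𝔤`-modules that corresponds to a weight `μ` with `μ(h̄) ≠ 0`:
the full subcategory of all modules in `X` whose simple subquotients are all isomorphic to
`L(μ)`. -/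
def block (X : ObjectProperty (ModuleCat.{0} U)) (μ : Weight) :
    ObjectProperty (ModuleCat.{0} U) := fun M =>
  X M ∧ ∀ (N : Submodule U M) (P : Submodule U N),
    IsSimpleModule U (N ⧸ P) → Nonempty ((N ⧸ P) ≃ₗ[U] simpleL μ)

/-- The finite-dimensional modules over a `ℂ`-algebra. -/
def finDim (R : Type) [Ring R] [Algebra ℂ R] : ObjectProperty (ModuleCat.{0} R) :=
  fun V => Module.Finite ℂ V

/-- The linear map `h̄ → R` with `h ↦ μ(h) + y` and `h̄ ↦ μ(h̄) + x`. -/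
def shiftedWeight {R : Type} [CommRing R] [Algebra ℂ R] (μ : Weight) (x y : R) :
    cartan →ₗ[ℂ] R :=
  Algebra.linearMap ℂ R ∘ₗ μ +
    (coordHBar.smulRight x + coordH.smulRight y) ∘ₗ cartan.toSubmodule.subtype

/-- Let `R` be a commutative `ℂ`-algebra and `x, y ∈ R`. There is an equivalence between the block
of `X` that corresponds to `μ` and the category of finite-dimensional `R`-modules, such that
the functor from the block sends `M` to the generalized weight space `M^μ`, with `x` and `y`
acting as `h̄ - μ(h̄)` and `h - μ(h)`, and the inverse functor is parabolic induction,
both up to natural isomorphism. -/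
def BlockEquivalence (X : ObjectProperty (ModuleCat.{0} U)) (μ : Weight)
    (R : Type) [CommRing R] [Algebra ℂ R] (x y : R) : Prop :=
  ∃ E : (block X μ).FullSubcategory ≌ (finDim R).FullSubcategory,
    Nonempty (E.functor ⋙ (finDim R).ι ⋙
        ModuleCat.restrictScalars (cartanHom (shiftedWeight μ x y)).toRingHom ≅
      (block X μ).ι ⋙ weightFunctor μ) ∧
    Nonempty (E.inverse ⋙ (block X μ).ι ≅
      (finDim R).ι ⋙ parabolicInd (shiftedWeight μ x y))

end TakiffSl2

end

/-!
Write `a = μ(h)` and `c = μ(h̄) ≠ 0`.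

The reason for the theorem is that the Casimir element `h h̄ + 2 h̄ + 2 f̄ e + 2 f ē` acts on a
highest weight vector of weight `(b, c)` by `c (b + 2)`, so for `c ≠ 0` it separates the weights
`b`. Call a module block-like (`IsBlockLike`) if `b̄` acts locally finitely, `h̄` has the only
generalized eigenvalue `c`, and the Casimir operator has the only generalized eigenvalue
`c (a + 2)`. This property passes to subquotients, and a nonzero block-like module has a highest
weight vector, which must be of weight exactly `(a, c)` (`IsBlockLike.exists_isHighest`).

Let `V` be a finite-dimensional space with commuting nilpotent operators `x = h̄ - c` and `y = h - a`.
The induced module is block-like because it is generated by `1 ⊗ V`. Differential operators on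
`ℂ[s, t] ⊗ V` give an explicit model of it, which replaces the Poincaré–Birkhoff–Witt theorem: it
shows that `V` embeds into the induced module, and that `1 ⊗ V` is the full generalized weight
space of weight `a` (`indMk_injective`, `mem_range_indMk`). The existence of highest weight vectors
has these consequences.

* The kernel of a homomorphism out of the induced module that is injective on `1 ⊗ V` has no highest
  weight vector, so it is zero (`HasWeight.injective_of_injective`). In particular the Verma module
  `Δ(μ)` is simple, and `L(μ) = Δ(μ)`.
* Every simple subquotient of the induced module receives a nonzero map from `Δ(μ)`, so it is
  isomorphic to `L(μ)`, and the induced module lies in the block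
  (`nonempty_equiv_simpleL`, `IsSeriesRing.block_ind`).

Conversely, let `M` be in the block. A nonzero generalized weight vector of `M` generates a module
with a simple quotient in which it remains nonzero, so its weight is a weight of `L(μ)`. Hence `e`
and `ē` kill the generalized `h`-eigenspace `M_a`, and `h̄ - c` is locally nilpotent on it; and `M_a`
generates `M` because otherwise the quotient would have a simple quotient without the weight `a`.
As `M` is finitely generated, a finite-dimensional stable subspace of `M_a` suffices, and `M` is
induced from it (`SimpleSubquotients.exists_generating`, `IsSeriesRing.exists_ind_equiv`).

So parabolic induction is essentially surjective onto the block. It is fully faithful because a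
homomorphism of induced modules preserves generalized weight spaces
(`IsSeriesRing.exists_map_eq`), and its quasi-inverse is the weight space functor since
`V ≅ 1 ⊗ V` is the weight space (`exists_weightSpace_equiv`). The power series rings enter only
through the properties collected in `IsSeriesRing`.
-/

noncomputable section

namespace TakiffSl2

attribute [local instance 100] LieRing.ofAssociativeRing

/-! ### Brackets and a basis of the Takiff algebra -/

lemma sl2e_lie_sl2f : ⁅sl2e, sl2f⁆ = sl2h := by
  refine Subtype.ext ?_
  refine (LieAlgebra.SpecialLinear.sl_bracket (n := Fin 2) (R := ℂ) sl2e sl2f).trans ?_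
  change (sl2e.val * sl2f.val - sl2f.val * sl2e.val : Matrix (Fin 2) (Fin 2) ℂ) =
    (sl2h.val : Matrix (Fin 2) (Fin 2) ℂ)
  ext i j
  fin_cases i <;> fin_cases j <;> simp [sl2e, sl2f, sl2h, Matrix.mul_apply, Matrix.single]

lemma sl2h_lie_sl2f : ⁅sl2h, sl2f⁆ = (-2 : ℂ) • sl2f := by
  refine Subtype.ext ?_
  refine (LieAlgebra.SpecialLinear.sl_bracket (n := Fin 2) (R := ℂ) sl2h sl2f).trans ?_
  change (sl2h.val * sl2f.val - sl2f.val * sl2h.val : Matrix (Fin 2) (Fin 2) ℂ) =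
    (-2 : ℂ) • (sl2f.val : Matrix (Fin 2) (Fin 2) ℂ)
  ext i j
  fin_cases i <;> fin_cases j <;> simp [sl2f, sl2h, Matrix.mul_apply, Matrix.single]
  norm_num

lemma h_lie_e : ⁅h, e⁆ = (2 : ℂ) • e := by simp [h, e, tens_lie_tens, sl2h_lie_sl2e]
lemma h_lie_eBar : ⁅h, eBar⁆ = (2 : ℂ) • eBar := by simp [h, eBar, tens_lie_tens, sl2h_lie_sl2e]
lemma h_lie_f : ⁅h, f⁆ = (-2 : ℂ) • f := by simp [h, f, tens_lie_tens, sl2h_lie_sl2f]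
lemma h_lie_fBar : ⁅h, fBar⁆ = (-2 : ℂ) • fBar := by
  simp [h, fBar, tens_lie_tens, sl2h_lie_sl2f]
lemma h_lie_hBar : ⁅h, hBar⁆ = 0 := by simp [h, hBar, tens_lie_tens]
lemma hBar_lie_e : ⁅hBar, e⁆ = (2 : ℂ) • eBar := by
  simp [hBar, e, eBar, tens_lie_tens, sl2h_lie_sl2e]
lemma hBar_lie_f : ⁅hBar, f⁆ = (-2 : ℂ) • fBar := by
  simp [hBar, f, fBar, tens_lie_tens, sl2h_lie_sl2f]
lemma hBar_lie_eBar : ⁅hBar, eBar⁆ = 0 := by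
  simp only [hBar, eBar, tens_lie_tens, eps_mul_eps, tens_zero]
lemma hBar_lie_fBar : ⁅hBar, fBar⁆ = 0 := by
  simp only [hBar, fBar, tens_lie_tens, eps_mul_eps, tens_zero]
lemma e_lie_f : ⁅e, f⁆ = h := by simp [h, e, f, tens_lie_tens, sl2e_lie_sl2f]
lemma e_lie_fBar : ⁅e, fBar⁆ = hBar := by simp [hBar, e, fBar, tens_lie_tens, sl2e_lie_sl2f]
lemma eBar_lie_f : ⁅eBar, f⁆ = hBar := by simp [hBar, eBar, f, tens_lie_tens, sl2e_lie_sl2f]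
lemma eBar_lie_fBar : ⁅eBar, fBar⁆ = 0 := by
  simp only [eBar, fBar, tens_lie_tens, eps_mul_eps, tens_zero]
lemma e_lie_eBar : ⁅e, eBar⁆ = 0 := by simp [e, eBar, tens_lie_tens]
lemma f_lie_fBar : ⁅f, fBar⁆ = 0 := by simp [f, fBar, tens_lie_tens]

/-- The matrix entry at `(i, j)`, as a linear form on `sl₂`. -/
def sl2Entry (i j : Fin 2) : Sl2 →ₗ[ℂ] ℂ :=
  Matrix.entryLinearMap ℂ ℂ i j ∘ₗ
    (LieAlgebra.SpecialLinear.sl (Fin 2) ℂ : Submodule ℂ (Matrix (Fin 2) (Fin 2) ℂ)).subtype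

lemma sl2_eq (a : Sl2) :
    a = sl2Entry 0 1 a • sl2e + sl2Entry 0 0 a • sl2h + sl2Entry 1 0 a • sl2f := by
  refine Subtype.ext ?_
  have ht : Matrix.trace a.val = 0 := a.2
  rw [Matrix.trace_fin_two] at ht
  change a.val = (a.val 0 1 • sl2e.val + a.val 0 0 • sl2h.val + a.val 1 0 • sl2f.val :
    Matrix (Fin 2) (Fin 2) ℂ)
  ext i j
  fin_cases i <;> fin_cases j <;> simp [sl2e, sl2f, sl2h, Matrix.single]
  linear_combination ht

/-- The six standard basis vectors of `𝔤`. -/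
def stdBasis : Set Takiff := {e, h, f, eBar, hBar, fBar}

lemma span_stdBasis : Submodule.span ℂ stdBasis = ⊤ := by
  refine eq_top_iff.2 fun x _ => ?_
  have key (s : DualNumber ℂ) (a : Sl2) : tens s a ∈ Submodule.span ℂ stdBasis := by
    have hs : s = s.fst • (1 : DualNumber ℂ) + s.snd • DualNumber.eps := by
      ext <;> simp
    have h1 (a b : ℂ) (v : Sl2) : tens (a • (1 : DualNumber ℂ) + b • DualNumber.eps) v =
        a • tens 1 v + b • tens DualNumber.eps v := by
      change (_ ⊗ₜ[ℂ] _ : DualNumber ℂ ⊗[ℂ] Sl2) = a • (_ ⊗ₜ[ℂ] _) + b • (_ ⊗ₜ[ℂ] _)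
      rw [TensorProduct.add_tmul, TensorProduct.smul_tmul', TensorProduct.smul_tmul']
      rfl
    rw [sl2_eq a, hs, h1]
    simp only [map_add, map_smul]
    have hm (y) (hy : y ∈ stdBasis) : y ∈ Submodule.span ℂ stdBasis := Submodule.subset_span hy
    have := hm e (by simp [stdBasis])
    have := hm f (by simp [stdBasis])
    have := hm h (by simp [stdBasis])
    have := hm eBar (by simp [stdBasis])
    have := hm fBar (by simp [stdBasis])
    have := hm hBar (by simp [stdBasis])
    refine add_mem (Submodule.smul_mem _ _ (add_mem (add_mem ?_ ?_) ?_))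
      (Submodule.smul_mem _ _ (add_mem (add_mem ?_ ?_) ?_)) <;>
    exact Submodule.smul_mem _ _ (by assumption)
  change (x : DualNumber ℂ ⊗[ℂ] Sl2) ∈ _ at *
  induction x using TensorProduct.induction_on with
  | zero => exact Submodule.zero_mem _
  | tmul s a => exact key s a
  | add x y hx hy => exact Submodule.add_mem _ (hx trivial) (hy trivial)

/-- A linear condition on elements of `𝔤` can be checked on the six basis vectors. -/
lemma mem_of_stdBasis (S : Submodule ℂ Takiff) (he : e ∈ S) (hh : h ∈ S) (hf : f ∈ S)
    (heb : eBar ∈ S) (hhb : hBar ∈ S) (hfb : fBar ∈ S) (x : Takiff) : x ∈ S := by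
  have : Submodule.span ℂ stdBasis ≤ S := by
    refine Submodule.span_le.2 ?_
    rintro _ (rfl | rfl | rfl | rfl | rfl | rfl) <;> assumption
  exact this (span_stdBasis ▸ Submodule.mem_top)

instance : Module.Finite ℂ Takiff :=
  ⟨span_stdBasis ▸ Submodule.fg_span (by simp [stdBasis])⟩

lemma e_mem_borel : e ∈ borel :=
  (le_sup_right : nPlus ≤ borel) (LieSubalgebra.subset_lieSpan (by simp))

lemma eBar_mem_borel : eBar ∈ borel :=
  (le_sup_right : nPlus ≤ borel) (LieSubalgebra.subset_lieSpan (by simp))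

lemma h_mem_borel : h ∈ borel := cartan_le_borel h_mem_cartan

lemma hBar_mem_borel : hBar ∈ borel := cartan_le_borel hBar_mem_cartan

/-- A linear condition on elements of the Borel subalgebra can be checked on `e, h, ē, h̄`. -/
lemma mem_of_borel (S : Submodule ℂ Takiff) (he : e ∈ S) (hh : h ∈ S)
    (heb : eBar ∈ S) (hhb : hBar ∈ S) (x : Takiff) (hx : x ∈ borel) : x ∈ S := by
  have : Submodule.span ℂ ({h, hBar, e, eBar} : Set Takiff) ≤ S := by
    refine Submodule.span_le.2 ?_
    rintro _ (rfl | rfl | rfl | rfl) <;> assumption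
  exact this (borel_le_span x hx)

/-! ### Subspaces stable under a Lie algebra -/

section Envelope

variable {L : Type} [LieRing L] [LieAlgebra ℂ L]

/-- A property that holds on a subalgebra containing the Lie algebra holds on the whole enveloping
algebra, since the Lie algebra generates it. -/
lemma envelope_induction {p : UniversalEnvelopingAlgebra ℂ L → Prop}
    (S : Subalgebra ℂ (UniversalEnvelopingAlgebra ℂ L))
    (hS : ∀ x : L, UniversalEnvelopingAlgebra.ι ℂ x ∈ S) (hp : ∀ u ∈ S, p u)
    (u : UniversalEnvelopingAlgebra ℂ L) : p u := by
  refine hp u ?_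
  let g : L →ₗ⁅ℂ⁆ S :=
    { toFun := fun x => ⟨UniversalEnvelopingAlgebra.ι ℂ x, hS x⟩
      map_add' := fun x y => Subtype.ext (by simp)
      map_smul' := fun x y => Subtype.ext (by simp)
      map_lie' := fun {x y} => Subtype.ext (by
        simp [LieRing.of_associative_ring_bracket]) }
  -- The Lie algebra maps to `S`; the induced map from the enveloping algebra to `S` is a section
  -- of the inclusion.
  have hg : S.val.comp (UniversalEnvelopingAlgebra.lift ℂ g) =
      AlgHom.id ℂ (UniversalEnvelopingAlgebra ℂ L) := by
    refine UniversalEnvelopingAlgebra.hom_ext ℂ (LieHom.ext fun x => ?_)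
    change ((UniversalEnvelopingAlgebra.lift ℂ g (UniversalEnvelopingAlgebra.ι ℂ x) : S) :
      UniversalEnvelopingAlgebra ℂ L) = UniversalEnvelopingAlgebra.ι ℂ x
    rw [UniversalEnvelopingAlgebra.lift_ι_apply]
    rfl
  have := congrArg (fun k => k u) hg
  change ((UniversalEnvelopingAlgebra.lift ℂ g u : S) :
      UniversalEnvelopingAlgebra ℂ L) = u at this
  rw [← this]
  exact Subtype.prop _

variable {M : Type} [AddCommGroup M] [Module ℂ M] [Module (UniversalEnvelopingAlgebra ℂ L) M]
  [IsScalarTower ℂ (UniversalEnvelopingAlgebra ℂ L) M]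

/-- A subspace that is stable under the Lie algebra is stable under its enveloping algebra. -/
lemma smul_mem_of_stable (T : Submodule ℂ M)
    (hT : ∀ (x : L), ∀ m ∈ T, UniversalEnvelopingAlgebra.ι ℂ x • m ∈ T)
    (u : UniversalEnvelopingAlgebra ℂ L) (m : M) (hm : m ∈ T) : u • m ∈ T := by
  revert m
  refine envelope_induction (p := fun u : UniversalEnvelopingAlgebra ℂ L => ∀ m ∈ T, u • m ∈ T)
    { carrier := {u : UniversalEnvelopingAlgebra ℂ L | ∀ m ∈ T, u • m ∈ T}
      mul_mem' := fun {a b} ha hb m hm => by rw [mul_smul]; exact ha _ (hb _ hm)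
      one_mem' := fun m hm => by rwa [one_smul]
      add_mem' := fun {a b} ha hb m hm => by rw [add_smul]; exact add_mem (ha _ hm) (hb _ hm)
      zero_mem' := fun m hm => by rw [zero_smul]; exact zero_mem _
      algebraMap_mem' := fun r m hm => by
        rw [algebraMap_smul]; exact T.smul_mem r hm } hT (fun u hu => hu) u

/-- A linear map that commutes with the Lie algebra commutes with its enveloping algebra. -/
lemma map_smul_of_lie {N : Type} [AddCommGroup N] [Module ℂ N]
    [Module (UniversalEnvelopingAlgebra ℂ L) N]
    [IsScalarTower ℂ (UniversalEnvelopingAlgebra ℂ L) N] (g : M →ₗ[ℂ] N)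
    (hg : ∀ (x : L) m, g (UniversalEnvelopingAlgebra.ι ℂ x • m) =
      UniversalEnvelopingAlgebra.ι ℂ x • g m)
    (u : UniversalEnvelopingAlgebra ℂ L) (m : M) : g (u • m) = u • g m := by
  revert m
  refine envelope_induction (p := fun u : UniversalEnvelopingAlgebra ℂ L => ∀ m, g (u • m) = u • g m)
    { carrier := {u : UniversalEnvelopingAlgebra ℂ L | ∀ m, g (u • m) = u • g m}
      mul_mem' := fun {a b} ha hb m => by rw [mul_smul, ha, hb, mul_smul]
      one_mem' := fun m => by rw [one_smul, one_smul]
      add_mem' := fun {a b} ha hb m => by rw [add_smul, map_add, ha, hb, add_smul]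
      zero_mem' := fun m => by rw [zero_smul, zero_smul, map_zero]
      algebraMap_mem' := fun r m => by
        rw [algebraMap_smul, algebraMap_smul, map_smul] } hg (fun u hu => hu) u

end Envelope

/-! ### The action of the Takiff algebra -/

section Action

variable {M : Type} [AddCommGroup M] [Module U M] [Module ℂ M] [IsScalarTower ℂ U M]

variable (M) in
/-- The action of `𝔤` on a `U(𝔤)`-module by linear operators. -/
def act : Takiff →ₗ[ℂ] Module.End ℂ M :=
  (Algebra.lsmul ℂ ℂ M).toLinearMap ∘ₗ (UniversalEnvelopingAlgebra.ι ℂ).toLinearMap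

lemma act_apply (x : Takiff) (m : M) :
    act M x m = (UniversalEnvelopingAlgebra.ι ℂ x : U) • m := rfl

lemma act_lie (x y : Takiff) (m : M) :
    act M ⁅x, y⁆ m = act M x (act M y m) - act M y (act M x m) := by
  simp only [act_apply]
  rw [LieHom.map_lie, LieRing.of_associative_ring_bracket, sub_smul, mul_smul, mul_smul]

/-- Swapping two elements of `𝔤`. -/
lemma act_comm (x y : Takiff) (m : M) :
    act M x (act M y m) = act M y (act M x m) + act M ⁅x, y⁆ m := by
  rw [act_lie]; abel

lemma map_act {N : Type} [AddCommGroup N] [Module U N] [Module ℂ N] [IsScalarTower ℂ U N]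
    (g : M →ₗ[U] N) (x : Takiff) (m : M) : g (act M x m) = act N x (g m) :=
  g.map_smul _ _

end Action

/-! ### Locally finite modules and highest weight vectors -/

section HighestWeight

variable {M : Type} [AddCommGroup M] [Module U M] [Module ℂ M] [IsScalarTower ℂ U M]
variable {N : Type} [AddCommGroup N] [Module U N] [Module ℂ N] [IsScalarTower ℂ U N]

/-- A vector that lies in a finite-dimensional `b̄`-stable subspace. -/
def BorelFinite (m : M) : Prop :=
  ∃ W : Submodule ℂ M, m ∈ W ∧ Module.Finite ℂ W ∧ ∀ x ∈ borel, ∀ w ∈ W, act M x w ∈ W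

lemma BorelFinite.add {m n : M} (hm : BorelFinite m) (hn : BorelFinite n) :
    BorelFinite (m + n) := by
  obtain ⟨W, hmW, hW, hWs⟩ := hm
  obtain ⟨X, hnX, hX, hXs⟩ := hn
  refine ⟨W ⊔ X, Submodule.add_mem_sup hmW hnX, inferInstance, fun x hx w hw => ?_⟩
  obtain ⟨y, hy, z, hz, rfl⟩ := Submodule.mem_sup.1 hw
  rw [map_add]
  exact Submodule.add_mem_sup (hWs x hx y hy) (hXs x hx z hz)

lemma BorelFinite.csmul {m : M} (hm : BorelFinite m) (t : ℂ) : BorelFinite (t • m) := by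
  obtain ⟨W, hmW, hW, hWs⟩ := hm
  exact ⟨W, W.smul_mem t hmW, hW, hWs⟩

/-- If `W` is finite-dimensional and `b̄`-stable, then so is `W + 𝔤 W`. -/
lemma BorelFinite.act {m : M} (hm : BorelFinite m) (x : Takiff) : BorelFinite (act M x m) := by
  obtain ⟨W, hmW, hW, hWs⟩ := hm
  refine ⟨Submodule.map₂ (TakiffSl2.act M) ⊤ W ⊔ W,
    Submodule.mem_sup_left (Submodule.apply_mem_map₂ _ trivial hmW), ?_, fun y hy w hw => ?_⟩
  · have : Module.Finite ℂ (Submodule.map₂ (TakiffSl2.act M) ⊤ W) :=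
      Module.Finite.iff_fg.2 (Submodule.FG.map₂ _ Module.Finite.fg_top (Module.Finite.iff_fg.1 hW))
    infer_instance
  · obtain ⟨p, hp, q, hq, rfl⟩ := Submodule.mem_sup.1 hw
    rw [map_add]
    refine add_mem ?_ (Submodule.mem_sup_right (hWs y hy q hq))
    have hle : Submodule.map₂ (TakiffSl2.act M) ⊤ W ≤
        (Submodule.map₂ (TakiffSl2.act M) ⊤ W ⊔ W).comap (TakiffSl2.act M y) := by
      refine Submodule.map₂_le.2 fun z _ n hn => Submodule.mem_comap.2 ?_
      rw [act_comm]
      exact Submodule.mem_sup_left (add_mem (Submodule.apply_mem_map₂ _ trivial (hWs y hy n hn))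
        (Submodule.apply_mem_map₂ _ trivial hn))
    exact hle hp

variable (M) in
/-- The subspace of vectors on which `b̄` acts locally finitely. -/
def borelFinitePart : Submodule ℂ M where
  carrier := {m | BorelFinite m}
  add_mem' := BorelFinite.add
  zero_mem' := ⟨⊥, zero_mem _, inferInstance, fun x _ w hw => by
    rw [(Submodule.mem_bot ℂ).1 hw, map_zero]; exact zero_mem _⟩
  smul_mem' := fun t _ hm => BorelFinite.csmul hm t

lemma BorelFinite.map (g : M →ₗ[U] N) {m : M} (hm : BorelFinite m) : BorelFinite (g m) := by
  obtain ⟨W, hmW, hW, hWs⟩ := hm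
  refine ⟨W.map (g.restrictScalars ℂ), ⟨m, hmW, rfl⟩, inferInstance, ?_⟩
  rintro x hx _ ⟨w, hw, rfl⟩
  exact ⟨TakiffSl2.act M x w, hWs x hx w hw, map_act g x w⟩

lemma BorelFinite.of_map (g : M →ₗ[U] N) (hg : Function.Injective g) {m : M}
    (hm : BorelFinite (g m)) : BorelFinite m := by
  obtain ⟨W, hmW, hW, hWs⟩ := hm
  refine ⟨W.comap (g.restrictScalars ℂ), hmW, ?_, fun x hx w hw => ?_⟩
  · exact Module.Finite.of_injective
      ((g.restrictScalars ℂ).restrict (p := W.comap (g.restrictScalars ℂ)) (q := W)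
        (fun _ hx => hx))
      (fun a b hab => Subtype.ext (hg (congrArg Subtype.val hab)))
  · change g (TakiffSl2.act M x w) ∈ W
    rw [map_act]
    exact hWs x hx _ hw

/-- A vector is a generalized eigenvector as soon as its image under `A - b` is one. -/
lemma mem_maxGenEigenspace_of_sub {V : Type} [AddCommGroup V] [Module ℂ V] {A : Module.End ℂ V}
    {b : ℂ} {m : V} (hm : A m - b • m ∈ A.maxGenEigenspace b) : m ∈ A.maxGenEigenspace b := by
  rw [Module.End.mem_maxGenEigenspace] at hm ⊢
  obtain ⟨k, hk⟩ := hm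
  exact ⟨k + 1, by rw [pow_succ, Module.End.mul_apply]; simpa using hk⟩

/-- To prove a property of generalized eigenvectors, one may suppose it for their images under
`A - b`. -/
lemma maxGenEigenspace_induction {V : Type} [AddCommGroup V] [Module ℂ V] {A : Module.End ℂ V}
    {b : ℂ} {p : V → Prop} (h0 : p 0) (hs : ∀ m, p (A m - b • m) → p m) {m : V}
    (hm : m ∈ A.maxGenEigenspace b) : p m := by
  obtain ⟨k, hk⟩ := (Module.End.mem_maxGenEigenspace _ _ _).1 hm
  clear hm
  induction k generalizing m with
  | zero => simp at hk; rwa [hk]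
  | succ k ih =>
    refine hs m (ih ?_)
    rw [pow_succ, Module.End.mul_apply] at hk
    simpa using hk

lemma map_mem_maxGenEigenspace {V W : Type} [AddCommGroup V] [Module ℂ V] [AddCommGroup W]
    [Module ℂ W] {A : Module.End ℂ V} {B : Module.End ℂ W} (g : V →ₗ[ℂ] W) (b : ℂ)
    (hg : ∀ v, g (A v) = B (g v)) {v : V} (hv : v ∈ A.maxGenEigenspace b) :
    g v ∈ B.maxGenEigenspace b := by
  refine maxGenEigenspace_induction (p := fun v => g v ∈ B.maxGenEigenspace b) ?_ ?_ hv
  · rw [map_zero]; exact zero_mem _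
  · intro m hm
    rw [map_sub, hg, map_smul] at hm
    exact mem_maxGenEigenspace_of_sub hm

lemma mem_maxGenEigenspace_of_map {V W : Type} [AddCommGroup V] [Module ℂ V] [AddCommGroup W]
    [Module ℂ W] {A : Module.End ℂ V} {B : Module.End ℂ W} (g : V →ₗ[ℂ] W) (b : ℂ)
    (hg : ∀ v, g (A v) = B (g v)) (hi : Function.Injective g) {v : V}
    (hv : g v ∈ B.maxGenEigenspace b) : v ∈ A.maxGenEigenspace b := by
  have key : ∀ w ∈ B.maxGenEigenspace b, ∀ v, g v = w → v ∈ A.maxGenEigenspace b := by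
    intro w hw
    refine maxGenEigenspace_induction
      (p := fun w => ∀ v, g v = w → v ∈ A.maxGenEigenspace b) ?_ ?_ hw
    · intro v hv
      rw [hi (hv.trans (map_zero g).symm)]
      exact zero_mem _
    · rintro m hm v rfl
      refine mem_maxGenEigenspace_of_sub (hm _ ?_)
      rw [map_sub, hg, map_smul]
  exact key _ hv v rfl

/-- Generalized eigenspaces are independent. -/
lemma eq_zero_of_mem_iSup_maxGenEigenspace {V ι : Type} [AddCommGroup V] [Module ℂ V]
    {A : Module.End ℂ V} {a : ℂ} {b : ι → ℂ} {p : ι → Submodule ℂ V}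
    (hp : ∀ i, p i ≤ A.maxGenEigenspace (b i)) (hb : ∀ i, b i ≠ a) {z : V}
    (hz : z ∈ A.maxGenEigenspace a) (hz' : z ∈ ⨆ i, p i) : z = 0 := by
  have hle : ⨆ i, p i ≤ ⨆ (b : ℂ) (_ : b ≠ a), A.maxGenEigenspace b :=
    iSup_le fun i => le_iSup₂_of_le _ (hb i) (hp i)
  simpa using (A.independent_maxGenEigenspace a).le_bot ⟨hz, hle hz'⟩

/-- A vector in a finite-dimensional stable subspace is a sum of generalized eigenvectors. -/
lemma mem_iSup_maxGenEigenspace {V : Type} [AddCommGroup V] [Module ℂ V] {A : Module.End ℂ V}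
    {W : Submodule ℂ V} [Module.Finite ℂ W] (hW : ∀ w ∈ W, A w ∈ W) {w : V} (hw : w ∈ W) :
    w ∈ ⨆ b : ℂ, A.maxGenEigenspace b := by
  let B : Module.End ℂ W := A.restrict hW
  have hle : ⨆ b : ℂ, B.maxGenEigenspace b ≤
      (⨆ b : ℂ, A.maxGenEigenspace b).comap W.subtype :=
    iSup_le fun b u hu => Submodule.mem_iSup_of_mem b
      (map_mem_maxGenEigenspace (A := B) W.subtype b (fun _ => rfl) hu)
  exact ((Module.End.iSup_maxGenEigenspace_eq_top B).ge.trans hle)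
    (Submodule.mem_top (x := (⟨w, hw⟩ : W)))

/-- An operator on a finite-dimensional space with the only eigenvalue `c` has the only generalized
eigenspace `c`. -/
lemma maxGenEigenspace_eq_top {V : Type} [AddCommGroup V] [Module ℂ V] [Module.Finite ℂ V]
    {A : Module.End ℂ V} {c : ℂ} (hc : ∀ b, A.HasEigenvalue b → b = c) (v : V) :
    v ∈ A.maxGenEigenspace c := by
  have hle : ⨆ b : ℂ, A.maxGenEigenspace b ≤ A.maxGenEigenspace c := by
    refine iSup_le fun b => ?_
    by_cases hb : A.HasEigenvalue b
    · rw [hc b hb]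
    · have : A.maxGenEigenspace b = ⊥ := by
        by_contra hne
        exact hb (Module.End.HasUnifEigenvalue.lt zero_lt_one hne)
      rw [this]
      exact bot_le
  exact (Module.End.iSup_maxGenEigenspace_eq_top A).ge.trans hle Submodule.mem_top

/-- If `[x, y] = t y`, then `y` shifts the generalized eigenvalues of `x` by `t`. -/
lemma act_mem_maxGenEigenspace {x y : Takiff} {t : ℂ} (hxy : ⁅x, y⁆ = t • y) {b : ℂ} {m : M}
    (hm : m ∈ (act M x).maxGenEigenspace b) :
    act M y m ∈ (act M x).maxGenEigenspace (b + t) := by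
  refine maxGenEigenspace_induction
    (p := fun m => act M y m ∈ (act M x).maxGenEigenspace (b + t)) ?_ ?_ hm
  · rw [map_zero]; exact zero_mem _
  · intro m hm
    refine mem_maxGenEigenspace_of_sub ?_
    rw [act_comm, hxy, map_smul, LinearMap.smul_apply]
    convert hm using 1
    rw [map_sub, map_smul]
    module

/-- Since `ad h̄` is nilpotent, generalized eigenspaces of `h̄` are stable under `𝔤`. -/
lemma act_mem_maxGenEigenspace_hBar {b : ℂ} (x : Takiff) {m : M}
    (hm : m ∈ (act M hBar).maxGenEigenspace b) :
    act M x m ∈ (act M hBar).maxGenEigenspace b := by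
  have h0 {x : Takiff} (hx : ⁅hBar, x⁆ = 0) {m : M}
      (hm : m ∈ (act M hBar).maxGenEigenspace b) :
      act M x m ∈ (act M hBar).maxGenEigenspace b := by
    simpa using act_mem_maxGenEigenspace (t := 0) (by rw [hx, zero_smul]) hm
  have h1 {x y : Takiff} {t : ℂ} (hx : ⁅hBar, x⁆ = t • y) (hy : ⁅hBar, y⁆ = 0) {m : M}
      (hm : m ∈ (act M hBar).maxGenEigenspace b) :
      act M x m ∈ (act M hBar).maxGenEigenspace b := by
    refine (maxGenEigenspace_induction
      (p := fun m => m ∈ (act M hBar).maxGenEigenspace b ∧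
        act M x m ∈ (act M hBar).maxGenEigenspace b) ?_ ?_ hm).2
    · rw [map_zero]; exact ⟨zero_mem _, zero_mem _⟩
    · rintro m ⟨hm, hxm⟩
      have hm' := mem_maxGenEigenspace_of_sub hm
      refine ⟨hm', mem_maxGenEigenspace_of_sub ?_⟩
      rw [act_comm, hx, map_smul, LinearMap.smul_apply]
      convert add_mem hxm (Submodule.smul_mem _ t (h0 hy hm')) using 1
      rw [map_sub, map_smul]
      abel
  have hh : ⁅hBar, h⁆ = (0 : ℂ) • e := by rw [← lie_skew, h_lie_hBar]; simp
  have : x ∈ (((act M hBar).maxGenEigenspace b).comap ((act M).flip m)) := by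
    refine mem_of_stdBasis _ ?_ ?_ ?_ ?_ ?_ ?_ x
    · exact h1 hBar_lie_e hBar_lie_eBar hm
    · exact h0 (by simpa using hh) hm
    · exact h1 hBar_lie_f hBar_lie_fBar hm
    · exact h0 hBar_lie_eBar hm
    · exact h0 (lie_self _) hm
    · exact h0 hBar_lie_fBar hm
  exact this

/-! The following rules reorder products of basis elements as `f, f̄, h, h̄, e, ē`. -/

lemma act_e_f (m : M) : act M e (act M f m) = act M f (act M e m) + act M h m := by
  rw [act_comm, e_lie_f]

lemma act_e_fBar (m : M) : act M e (act M fBar m) = act M fBar (act M e m) + act M hBar m := by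
  rw [act_comm, e_lie_fBar]

lemma act_eBar_f (m : M) : act M eBar (act M f m) = act M f (act M eBar m) + act M hBar m := by
  rw [act_comm, eBar_lie_f]

lemma act_eBar_fBar (m : M) : act M eBar (act M fBar m) = act M fBar (act M eBar m) := by
  rw [act_comm, eBar_lie_fBar, map_zero, LinearMap.zero_apply, add_zero]

lemma act_eBar_e (m : M) : act M eBar (act M e m) = act M e (act M eBar m) := by
  rw [act_comm, ← lie_skew, e_lie_eBar, neg_zero, map_zero, LinearMap.zero_apply, add_zero]

lemma act_fBar_f (m : M) : act M fBar (act M f m) = act M f (act M fBar m) := by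
  rw [act_comm, ← lie_skew, f_lie_fBar, neg_zero, map_zero, LinearMap.zero_apply, add_zero]

lemma act_hBar_h (m : M) : act M hBar (act M h m) = act M h (act M hBar m) := by
  rw [act_comm, ← lie_skew, h_lie_hBar, neg_zero, map_zero, LinearMap.zero_apply, add_zero]

lemma act_e_h (m : M) : act M e (act M h m) = act M h (act M e m) - (2 : ℂ) • act M e m := by
  rw [act_comm, ← lie_skew, h_lie_e, map_neg, map_smul, LinearMap.neg_apply,
    LinearMap.smul_apply, sub_eq_add_neg]

lemma act_eBar_h (m : M) :
    act M eBar (act M h m) = act M h (act M eBar m) - (2 : ℂ) • act M eBar m := by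
  rw [act_comm, ← lie_skew, h_lie_eBar, map_neg, map_smul, LinearMap.neg_apply,
    LinearMap.smul_apply, sub_eq_add_neg]

lemma act_e_hBar (m : M) :
    act M e (act M hBar m) = act M hBar (act M e m) - (2 : ℂ) • act M eBar m := by
  rw [act_comm, ← lie_skew, hBar_lie_e, map_neg, map_smul, LinearMap.neg_apply,
    LinearMap.smul_apply, sub_eq_add_neg]

lemma act_eBar_hBar (m : M) : act M eBar (act M hBar m) = act M hBar (act M eBar m) := by
  rw [act_comm, ← lie_skew, hBar_lie_eBar, neg_zero, map_zero, LinearMap.zero_apply, add_zero]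

lemma act_h_f (m : M) : act M h (act M f m) = act M f (act M h m) - (2 : ℂ) • act M f m := by
  rw [act_comm, h_lie_f, map_smul, LinearMap.smul_apply, neg_smul, sub_eq_add_neg]

lemma act_h_fBar (m : M) :
    act M h (act M fBar m) = act M fBar (act M h m) - (2 : ℂ) • act M fBar m := by
  rw [act_comm, h_lie_fBar, map_smul, LinearMap.smul_apply, neg_smul, sub_eq_add_neg]

lemma act_hBar_f (m : M) :
    act M hBar (act M f m) = act M f (act M hBar m) - (2 : ℂ) • act M fBar m := by
  rw [act_comm, hBar_lie_f, map_smul, LinearMap.smul_apply, neg_smul, sub_eq_add_neg]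

lemma act_hBar_fBar (m : M) : act M hBar (act M fBar m) = act M fBar (act M hBar m) := by
  rw [act_comm, hBar_lie_fBar, map_zero, LinearMap.zero_apply, add_zero]

variable (M) in
/-- The Casimir operator `h h̄ + 2 h̄ + 2 f̄ e + 2 f ē`. -/
def casimir : Module.End ℂ M :=
  act M h * act M hBar + (2 : ℂ) • act M hBar + (2 : ℂ) • (act M fBar * act M e) +
    (2 : ℂ) • (act M f * act M eBar)

lemma casimir_apply (m : M) : casimir M m =
    act M h (act M hBar m) + (2 : ℂ) • act M hBar m + (2 : ℂ) • act M fBar (act M e m) +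
      (2 : ℂ) • act M f (act M eBar m) := rfl

lemma map_casimir (g : M →ₗ[U] N) (m : M) : g (casimir M m) = casimir N (g m) := by
  have hc (t : ℂ) (m : M) : g (t • m) = t • g m := (g.restrictScalars ℂ).map_smul t m
  simp only [casimir_apply, map_add, hc, map_act]

/-- The Casimir operator is central. -/
lemma casimir_act (x : Takiff) (m : M) : casimir M (act M x m) = act M x (casimir M m) := by
  have : x ∈ LinearMap.ker ((LinearMap.llcomp ℂ M M M (casimir M)).comp (act M) -
      (LinearMap.lcomp ℂ M (casimir M)).comp (act M)) := by
    refine mem_of_stdBasis _ ?_ ?_ ?_ ?_ ?_ ?_ x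
    all_goals
      refine LinearMap.mem_ker.2 (LinearMap.ext fun m => ?_)
      change casimir M (act M _ m) - act M _ (casimir M m) = 0
      simp only [casimir_apply, map_add, map_sub, map_smul, act_e_f, act_e_fBar, act_eBar_f,
        act_eBar_fBar, act_eBar_e, act_fBar_f, act_hBar_h, act_e_h, act_eBar_h, act_e_hBar,
        act_eBar_hBar, act_h_f, act_h_fBar, act_hBar_f, act_hBar_fBar]
      module
  exact sub_eq_zero.1 (LinearMap.congr_fun (LinearMap.mem_ker.1 this) m)

lemma casimir_mem_maxGenEigenspace {b : ℂ} (x : Takiff) {m : M}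
    (hm : m ∈ (casimir M).maxGenEigenspace b) :
    act M x m ∈ (casimir M).maxGenEigenspace b :=
  map_mem_maxGenEigenspace (act M x) b (fun v => (casimir_act x v).symm) hm

/-- A vector of weight `(a, c)` killed by `n̄₊`; it may be zero. -/
structure IsHighest (a c : ℂ) (w : M) : Prop where
  e : act M e w = 0
  eBar : act M eBar w = 0
  h : act M h w = a • w
  hBar : act M hBar w = c • w

lemma IsHighest.casimir {a c : ℂ} {w : M} (hw : IsHighest a c w) :
    casimir M w = (c * (a + 2)) • w := by
  rw [casimir_apply, hw.e, hw.eBar, hw.hBar, map_smul, hw.h]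
  simp only [map_zero]
  module

lemma IsHighest.map {a c : ℂ} {w : M} (hw : IsHighest a c w) (g : M →ₗ[U] N) :
    IsHighest a c (g w) := by
  have hc (t : ℂ) (m : M) : g (t • m) = t • g m := (g.restrictScalars ℂ).map_smul t m
  constructor <;> rw [← map_act]
  · rw [hw.e, map_zero]
  · rw [hw.eBar, map_zero]
  · rw [hw.h, hc]
  · rw [hw.hBar, hc]

/-- A nonzero locally finite module has a highest weight vector: an eigenvector of `h̄` in an
eigenspace of `h` whose eigenvalue has the largest real part. -/
lemma exists_isHighest_of_borelFinite [Nontrivial M] (hM : ∀ m : M, BorelFinite m) :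
    ∃ (w : M) (a c : ℂ), w ≠ 0 ∧ IsHighest a c w := by
  obtain ⟨m, hm⟩ := exists_ne (0 : M)
  obtain ⟨W, hmW, hW, hWs⟩ := hM m
  have : Nontrivial W := ⟨⟨⟨m, hmW⟩, 0, fun hh => hm (congrArg Subtype.val hh)⟩⟩
  let H : Module.End ℂ W := (act M h).restrict (hWs h h_mem_borel)
  have hfin : Set.Finite {b : ℂ | H.HasEigenvalue b} := Module.End.finite_hasEigenvalue H
  obtain ⟨b, hb, hmax⟩ := Set.exists_max_image _ Complex.re hfin
    (Module.End.exists_eigenvalue H)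
  let E : Submodule ℂ M := W ⊓ (act M h).eigenspace b
  have : Nontrivial E := by
    obtain ⟨v, hv⟩ := Module.End.HasEigenvalue.exists_hasEigenvector hb
    refine ⟨⟨⟨v, v.2, ?_⟩, 0, fun hh => hv.2 (Subtype.ext (congrArg (fun z : E => (z : M)) hh))⟩⟩
    exact Module.End.mem_eigenspace_iff.2
      (congrArg Subtype.val (Module.End.mem_eigenspace_iff.1 hv.1))
  have : Module.Finite ℂ E := Submodule.finiteDimensional_of_le (inf_le_left : E ≤ W)
  have hE : ∀ v ∈ E, act M hBar v ∈ E := by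
    rintro v ⟨hvW, hv⟩
    refine ⟨hWs _ hBar_mem_borel _ hvW, Module.End.mem_eigenspace_iff.2 ?_⟩
    rw [act_comm, Module.End.mem_eigenspace_iff.1 hv, h_lie_hBar]
    simp
  obtain ⟨c, hc⟩ := Module.End.exists_eigenvalue ((act M hBar).restrict hE)
  obtain ⟨v, hv⟩ := hc.exists_hasEigenvector
  have hvh : act M h v = b • (v : M) := Module.End.mem_eigenspace_iff.1 v.2.2
  have key {x : Takiff} (hx : x ∈ borel) (hhx : ⁅h, x⁆ = (2 : ℂ) • x) : act M x v = 0 := by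
    by_contra hne
    have h2 : H.HasEigenvalue (b + 2) := by
      refine Module.End.hasEigenvalue_of_hasEigenvector
        (x := ⟨act M x v, hWs x hx _ v.2.1⟩) ⟨Module.End.mem_eigenspace_iff.2
          (Subtype.ext ?_), fun h0 => hne (congrArg Subtype.val h0)⟩
      change act M h (act M x v) = (b + 2) • act M x v
      rw [act_comm, hvh, hhx]
      simp only [map_smul, LinearMap.smul_apply]
      module
    have := hmax _ h2
    simp at this
    linarith
  exact ⟨v, b, c, fun h0 => hv.2 (Subtype.ext h0), key e_mem_borel h_lie_e,
    key eBar_mem_borel h_lie_eBar, hvh,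
    congrArg Subtype.val (Module.End.mem_eigenspace_iff.1 hv.1)⟩

variable (M) in
/-- The `b̄`-locally finite modules on which `h̄` has the only generalized eigenvalue `c` and the
Casimir operator the only generalized eigenvalue `c (a + 2)`. -/
structure IsBlockLike (a c : ℂ) : Prop where
  hBar (m : M) : m ∈ (act M hBar).maxGenEigenspace c
  casimir (m : M) : m ∈ (casimir M).maxGenEigenspace (c * (a + 2))
  fin (m : M) : BorelFinite m

lemma IsBlockLike.of_surjective {a c : ℂ} (hM : IsBlockLike M a c) (g : M →ₗ[U] N)
    (hg : Function.Surjective g) : IsBlockLike N a c := by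
  constructor <;> intro n <;> obtain ⟨m, rfl⟩ := hg n
  · exact map_mem_maxGenEigenspace (g.restrictScalars ℂ) c (fun v => map_act g _ v) (hM.hBar m)
  · exact map_mem_maxGenEigenspace (g.restrictScalars ℂ) _ (fun v => map_casimir g v)
      (hM.casimir m)
  · exact (hM.fin m).map g

lemma IsBlockLike.of_injective {a c : ℂ} (hN : IsBlockLike N a c) (g : M →ₗ[U] N)
    (hg : Function.Injective g) : IsBlockLike M a c := by
  constructor <;> intro m
  · exact mem_maxGenEigenspace_of_map (g.restrictScalars ℂ) c (fun v => map_act g _ v) hg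
      (hN.hBar _)
  · exact mem_maxGenEigenspace_of_map (g.restrictScalars ℂ) _ (fun v => map_casimir g v) hg
      (hN.casimir _)
  · exact (hN.fin _).of_map g hg

/-- The conditions of `IsBlockLike` can be checked on generators. -/
lemma IsBlockLike.of_generators {a c : ℂ} (S : Set M) (hS : Submodule.span U S = ⊤)
    (h1 : ∀ m ∈ S, m ∈ (act M TakiffSl2.hBar).maxGenEigenspace c)
    (h2 : ∀ m ∈ S, m ∈ (TakiffSl2.casimir M).maxGenEigenspace (c * (a + 2)))
    (h3 : ∀ m ∈ S, BorelFinite m) : IsBlockLike M a c := by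
  have key (T : Submodule ℂ M) (hT : ∀ x : Takiff, ∀ m ∈ T, act M x m ∈ T) (hST : S ⊆ T) (m : M) :
      m ∈ T := by
    have hm : m ∈ Submodule.span U S := hS ▸ Submodule.mem_top
    induction hm using Submodule.span_induction with
    | mem m hm => exact hST hm
    | zero => exact zero_mem _
    | add m n _ _ hm hn => exact add_mem hm hn
    | smul u m _ hm => exact smul_mem_of_stable T hT u m hm
  exact ⟨key _ (fun x m hm => act_mem_maxGenEigenspace_hBar x hm) h1,
    key _ (fun x m hm => casimir_mem_maxGenEigenspace x hm) h2,
    key (borelFinitePart M) (fun x m hm => BorelFinite.act hm x) h3⟩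

lemma eq_of_mem_maxGenEigenspace {V : Type} [AddCommGroup V] [Module ℂ V] {A : Module.End ℂ V}
    {b c : ℂ} {v : V} (hv : v ≠ 0) (hb : A v = b • v) (hc : v ∈ A.maxGenEigenspace c) : b = c := by
  by_contra hne
  have := (A.disjoint_genEigenspace hne ⊤ ⊤).le_bot
    ⟨A.eigenspace_le_maxGenEigenspace (Module.End.mem_eigenspace_iff.2 hb), hc⟩
  exact hv this

/-- The eigenvalue of the Casimir operator determines the highest weight since `c ≠ 0`. -/
lemma IsBlockLike.exists_isHighest [Nontrivial M] {a c : ℂ} (hc : c ≠ 0)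
    (hM : IsBlockLike M a c) : ∃ w : M, w ≠ 0 ∧ IsHighest a c w := by
  obtain ⟨w, a', c', hw, hhw⟩ := exists_isHighest_of_borelFinite hM.fin
  obtain rfl := eq_of_mem_maxGenEigenspace hw hhw.hBar (hM.hBar w)
  have := eq_of_mem_maxGenEigenspace hw hhw.casimir (hM.casimir w)
  obtain rfl : a' = a := by simpa [hc] using this
  exact ⟨w, hw, hhw⟩

end HighestWeight

/-! ### The universal property of parabolic induction -/

section Induced

variable {R : Type} [CommRing R] [Algebra ℂ R] (φ : cartan →ₗ[ℂ] R) (V : ModuleCat.{0} R)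

lemma borelHom_ι (z : borel) :
    borelHom φ (UniversalEnvelopingAlgebra.ι ℂ z) = φ (proj z) :=
  UniversalEnvelopingAlgebra.lift_ι_apply _ _ _

lemma inclB_ι (z : borel) :
    inclB (UniversalEnvelopingAlgebra.ι ℂ z) = UniversalEnvelopingAlgebra.ι ℂ (z : Takiff) :=
  UniversalEnvelopingAlgebra.lift_ι_apply _ _ _

lemma inclH_ι (z : cartan) :
    inclH (UniversalEnvelopingAlgebra.ι ℂ z) = UniversalEnvelopingAlgebra.ι ℂ (z : Takiff) :=
  UniversalEnvelopingAlgebra.lift_ι_apply _ _ _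

lemma cartanHom_ι (z : cartan) :
    cartanHom φ (UniversalEnvelopingAlgebra.ι ℂ z) = φ z :=
  UniversalEnvelopingAlgebra.lift_ι_apply _ _ _

/-- An `R`-module as a `b̄`-module, with `n̄₊` acting by zero. -/
abbrev inflation : ModuleCat.{0} UB := (ModuleCat.restrictScalars (borelHom φ).toRingHom).obj V

/-- The class of `1 ⊗ v`. -/
def indMkAux (v : V) : (parabolicInd φ).obj V :=
  Submodule.Quotient.mk (p := indRel inclB.toRingHom (inflation φ V)) ((1 : U) ⊗ₜ[ℤ] (v : inflation φ V))

lemma inclB_smul_indMkAux (b : UB) (v : V) :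
    inclB b • indMkAux φ V v = indMkAux φ V (borelHom φ b • v) := by
  refine (Submodule.Quotient.eq (indRel inclB.toRingHom (inflation φ V))).2 (Submodule.subset_span ?_)
  refine ⟨1, b, v, ?_⟩
  rw [one_mul]
  exact congrArg (· - _) ((TensorProduct.smul_tmul' (R := ℤ) (inclB b) (1 : U)
    (v : inflation φ V)).trans (by rw [smul_eq_mul, mul_one]; rfl))

/-- The canonical map `V → U(𝔤) ⊗ V`, `v ↦ 1 ⊗ v`. -/
def indMk : V →ₗ[ℂ] (parabolicInd φ).obj V where
  toFun := indMkAux φ V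
  map_add' v w := by
    refine (congrArg (Submodule.Quotient.mk (p := indRel inclB.toRingHom (inflation φ V)))
        (TensorProduct.tmul_add (1 : U) (v : inflation φ V) (w : inflation φ V))).trans ?_
    rfl
  map_smul' t v := by
    have := inclB_smul_indMkAux φ V (algebraMap ℂ UB t) v
    rw [AlgHom.commutes, AlgHom.commutes, algebraMap_smul, algebraMap_smul] at this
    exact this.symm

lemma act_indMk_of_mem_borel {z : Takiff} (hz : z ∈ borel) (v : V) :
    act _ z (indMk φ V v) = indMk φ V (φ (proj z) • v) := by
  have := inclB_smul_indMkAux φ V (UniversalEnvelopingAlgebra.ι ℂ ⟨z, hz⟩) v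
  rw [inclB_ι, borelHom_ι] at this
  exact this

lemma act_e_indMk (v : V) : act _ e (indMk φ V v) = 0 := by
  rw [act_indMk_of_mem_borel φ V e_mem_borel, proj_e, map_zero, zero_smul, map_zero]

lemma act_eBar_indMk (v : V) : act _ eBar (indMk φ V v) = 0 := by
  rw [act_indMk_of_mem_borel φ V eBar_mem_borel, proj_eBar, map_zero, zero_smul, map_zero]

lemma act_h_indMk (v : V) : act _ h (indMk φ V v) = indMk φ V (φ hC • v) := by
  rw [act_indMk_of_mem_borel φ V h_mem_borel, proj_h]

lemma act_hBar_indMk (v : V) : act _ hBar (indMk φ V v) = indMk φ V (φ hBarC • v) := by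
  rw [act_indMk_of_mem_borel φ V hBar_mem_borel, proj_hBar]

/-- The induced module is generated by the vectors `1 ⊗ v`. -/
lemma span_range_indMk : Submodule.span U (Set.range (indMk φ V)) = ⊤ := by
  refine eq_top_iff.2 fun x _ => ?_
  obtain ⟨z, rfl⟩ := Submodule.Quotient.mk_surjective (indRel inclB.toRingHom (inflation φ V)) x
  induction z using TensorProduct.induction_on with
  | zero => exact Submodule.zero_mem _
  | tmul u v =>
    have : u • indMk φ V v ∈ Submodule.span U (Set.range (indMk φ V)) :=
      Submodule.smul_mem _ _ (Submodule.subset_span ⟨v, rfl⟩)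
    have hu : Submodule.Quotient.mk (p := indRel inclB.toRingHom (inflation φ V)) (u ⊗ₜ[ℤ] v) =
        u • indMk φ V v := by
      refine congrArg (Submodule.Quotient.mk (p := indRel inclB.toRingHom (inflation φ V)))
        (a₂ := u • ((1 : U) ⊗ₜ[ℤ] v)) ?_
      rw [TensorProduct.smul_tmul', smul_eq_mul, mul_one]
    exact hu ▸ this
  | add y z hy hz => exact Submodule.add_mem _ (hy trivial) (hz trivial)

variable {M : Type} [AddCommGroup M] [Module U M]

/-- Linear maps out of an induced module agree if they agree on `1 ⊗ V`. -/
lemma ind_hom_ext {g g' : (parabolicInd φ).obj V →ₗ[U] M}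
    (hg : ∀ v, g (indMk φ V v) = g' (indMk φ V v)) : g = g' :=
  LinearMap.ext_on (span_range_indMk φ V) (by rintro _ ⟨v, rfl⟩; exact hg v)

section Lift

variable [Module ℂ M] (g : V →ₗ[ℂ] M)

/-- The map `U(𝔤) ⊗_ℤ V → M` given by a linear map `V → M`. -/
def indLiftAux : U ⊗[ℤ] inflation φ V →ₗ[U] M :=
  TensorProduct.AlgebraTensorModule.lift
    { toFun := fun u =>
        { toFun := fun v : V => u • g v
          map_add' := fun v w : V => (congrArg (u • ·) (map_add g v w)).trans (smul_add _ _ _)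
          map_smul' := fun (n : ℤ) (v : V) =>
            (congrArg (u • ·) (map_zsmul g n v)).trans (smul_comm _ _ _) }
      map_add' := fun u u' => LinearMap.ext fun v : V => add_smul u u' (g v)
      map_smul' := fun u u' => LinearMap.ext fun v : V => mul_smul u u' (g v) }

lemma indLiftAux_tmul (u : U) (v : V) : indLiftAux φ V g (u ⊗ₜ[ℤ] (v : inflation φ V)) = u • g v := rfl

variable [IsScalarTower ℂ U M] (he : ∀ v, act M e (g v) = 0) (heb : ∀ v, act M eBar (g v) = 0)
  (hh : ∀ v, act M h (g v) = g (φ hC • v)) (hhb : ∀ v, act M hBar (g v) = g (φ hBarC • v))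

include he heb hh hhb

lemma indLift_borel (z : Takiff) (hz : z ∈ borel) (v : V) :
    g (φ (proj z) • v) = act M z (g v) := by
  have : z ∈ LinearMap.ker ((g ∘ₗ (LinearMap.toSpanSingleton R V v).restrictScalars ℂ ∘ₗ φ ∘ₗ proj)
      - (act M).flip (g v)) := by
    refine mem_of_borel _ ?_ ?_ ?_ ?_ z hz <;> refine LinearMap.mem_ker.2 (sub_eq_zero.2 ?_)
    · change g (φ (proj e) • v) = act M e (g v)
      rw [proj_e, map_zero, zero_smul, map_zero, he]
    · change g (φ (proj h) • v) = act M h (g v)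
      rw [proj_h, hh]
    · change g (φ (proj eBar) • v) = act M eBar (g v)
      rw [proj_eBar, map_zero, zero_smul, map_zero, heb]
    · change g (φ (proj hBar) • v) = act M hBar (g v)
      rw [proj_hBar, hhb]
  exact sub_eq_zero.1 (LinearMap.mem_ker.1 this)

lemma indLift_smul (b : UB) (v : V) : g (borelHom φ b • v) = inclB b • g v := by
  revert v
  refine envelope_induction (p := fun b : UB => ∀ v, g (borelHom φ b • v) = inclB b • g v)
    { carrier := {b : UB | ∀ v, g (borelHom φ b • v) = inclB b • g v}
      mul_mem' := fun {a b} ha hb m => by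
        rw [map_mul, mul_smul, ha, hb, map_mul, mul_smul]
      one_mem' := fun m => by rw [map_one, one_smul, map_one, one_smul]
      add_mem' := fun {a b} ha hb m => by
        rw [map_add, add_smul, map_add, ha, hb, map_add, add_smul]
      zero_mem' := fun m => by rw [map_zero, map_zero, zero_smul, zero_smul, map_zero]
      algebraMap_mem' := fun r m => by
        rw [AlgHom.commutes, AlgHom.commutes, algebraMap_smul, algebraMap_smul, map_smul] }
    (fun z v => ?_) (fun u hu => hu) b
  rw [borelHom_ι, inclB_ι]
  exact indLift_borel φ V g he heb hh hhb z z.2 v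

/-- The universal property of parabolic induction. -/
def indLift : (parabolicInd φ).obj V →ₗ[U] M :=
  (indRel inclB.toRingHom (inflation φ V)).liftQ (indLiftAux φ V g) (by
      refine Submodule.span_le.2 ?_
      rintro _ ⟨u, b, v, rfl⟩
      refine LinearMap.mem_ker.2 ((map_sub (indLiftAux φ V g) _ _).trans ?_)
      refine sub_eq_zero.2 ((indLiftAux_tmul φ V g _ _).trans ?_)
      refine Eq.trans ?_ (indLiftAux_tmul φ V g _ _).symm
      rw [mul_smul]
      exact congrArg (u • ·) (indLift_smul φ V g he heb hh hhb b v).symm)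

lemma indLift_indMk (v : V) : indLift φ V g he heb hh hhb (indMk φ V v) = g v :=
  (indLiftAux_tmul φ V g 1 v).trans (one_smul _ _)

end Lift

lemma parabolicInd_map_indMk {V W : ModuleCat.{0} R} (g : V ⟶ W) (v : V) :
    ((parabolicInd φ).map g).hom (indMk φ V v) = indMk φ W (g.hom v) := rfl

end Induced

/-! ### Differential operators that represent the Takiff algebra -/

/-- The linear form `s ⊗ a ↦ l(s) a(i, j)` on `𝔤`, where `a(i, j)` is a matrix entry of `a`. -/
def coordEntry (l : DualNumber ℂ →ₗ[ℂ] ℂ) (i j : Fin 2) : Takiff →ₗ[ℂ] ℂ :=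
  (TensorProduct.lid ℂ ℂ).toLinearMap ∘ₗ TensorProduct.map l (sl2Entry i j)

lemma coordEntry_tens (l : DualNumber ℂ →ₗ[ℂ] ℂ) (i j : Fin 2) (s : DualNumber ℂ) (a : Sl2) :
    coordEntry l i j (tens s a) = l s * sl2Entry i j a := by
  change TensorProduct.lid ℂ ℂ (TensorProduct.map l (sl2Entry i j) (s ⊗ₜ a)) = _
  simp

section LieHom

variable {A : Type} [Ring A] [Algebra ℂ A]

/-- The linear map from `𝔤` with given values on the basis. -/
def takiffLinear (E H F E' H' F' : A) : Takiff →ₗ[ℂ] A :=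
  (coordEntry (TrivSqZeroExt.fstHom ℂ ℂ ℂ).toLinearMap 0 1).smulRight E +
  (coordEntry (TrivSqZeroExt.fstHom ℂ ℂ ℂ).toLinearMap 0 0).smulRight H +
  (coordEntry (TrivSqZeroExt.fstHom ℂ ℂ ℂ).toLinearMap 1 0).smulRight F +
  (coordEntry (TrivSqZeroExt.sndHom ℂ ℂ) 0 1).smulRight E' +
  (coordEntry (TrivSqZeroExt.sndHom ℂ ℂ) 0 0).smulRight H' +
  (coordEntry (TrivSqZeroExt.sndHom ℂ ℂ) 1 0).smulRight F'

lemma sl2Entry_sl2e (i j : Fin 2) : sl2Entry i j sl2e = if i = 0 ∧ j = 1 then 1 else 0 := by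
  change (sl2e.val : Matrix (Fin 2) (Fin 2) ℂ) i j = _
  fin_cases i <;> fin_cases j <;> simp [sl2e]

lemma sl2Entry_sl2f (i j : Fin 2) : sl2Entry i j sl2f = if i = 1 ∧ j = 0 then 1 else 0 := by
  change (sl2f.val : Matrix (Fin 2) (Fin 2) ℂ) i j = _
  fin_cases i <;> fin_cases j <;> simp [sl2f]

lemma sl2Entry_sl2h (i j : Fin 2) :
    sl2Entry i j sl2h = if i = j then (if i = 0 then 1 else -1) else 0 := by
  change (sl2h.val : Matrix (Fin 2) (Fin 2) ℂ) i j = _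
  fin_cases i <;> fin_cases j <;> simp [sl2h, Matrix.single]

variable (E H F E' H' F' : A)

lemma takiffLinear_e : takiffLinear E H F E' H' F' e = E := by
  simp [takiffLinear, e, coordEntry_tens, sl2Entry_sl2e]

lemma takiffLinear_h : takiffLinear E H F E' H' F' h = H := by
  simp [takiffLinear, h, coordEntry_tens, sl2Entry_sl2h]

lemma takiffLinear_f : takiffLinear E H F E' H' F' f = F := by
  simp [takiffLinear, f, coordEntry_tens, sl2Entry_sl2f]

lemma takiffLinear_eBar : takiffLinear E H F E' H' F' eBar = E' := by
  simp [takiffLinear, eBar, coordEntry_tens, sl2Entry_sl2e]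

lemma takiffLinear_hBar : takiffLinear E H F E' H' F' hBar = H' := by
  simp [takiffLinear, hBar, coordEntry_tens, sl2Entry_sl2h]

lemma takiffLinear_fBar : takiffLinear E H F E' H' F' fBar = F' := by
  simp [takiffLinear, fBar, coordEntry_tens, sl2Entry_sl2f]

/-- A linear map that is compatible with the brackets of the basis vectors is compatible with all
brackets. -/
lemma map_lie_of_basis (ρ : Takiff →ₗ[ℂ] A)
    (he : ρ h * ρ e - ρ e * ρ h = (2 : ℂ) • ρ e)
    (heb : ρ h * ρ eBar - ρ eBar * ρ h = (2 : ℂ) • ρ eBar)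
    (hf : ρ h * ρ f - ρ f * ρ h = (-2 : ℂ) • ρ f)
    (hfb : ρ h * ρ fBar - ρ fBar * ρ h = (-2 : ℂ) • ρ fBar)
    (hhb : ρ h * ρ hBar - ρ hBar * ρ h = 0)
    (hbe : ρ hBar * ρ e - ρ e * ρ hBar = (2 : ℂ) • ρ eBar)
    (hbf : ρ hBar * ρ f - ρ f * ρ hBar = (-2 : ℂ) • ρ fBar)
    (hbeb : ρ hBar * ρ eBar - ρ eBar * ρ hBar = 0)
    (hbfb : ρ hBar * ρ fBar - ρ fBar * ρ hBar = 0)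
    (ef : ρ e * ρ f - ρ f * ρ e = ρ h)
    (efb : ρ e * ρ fBar - ρ fBar * ρ e = ρ hBar)
    (ebf : ρ eBar * ρ f - ρ f * ρ eBar = ρ hBar)
    (ebfb : ρ eBar * ρ fBar - ρ fBar * ρ eBar = 0)
    (eeb : ρ e * ρ eBar - ρ eBar * ρ e = 0)
    (ffb : ρ f * ρ fBar - ρ fBar * ρ f = 0) (x y : Takiff) :
    ρ ⁅x, y⁆ = ρ x * ρ y - ρ y * ρ x := by
  let B : Takiff →ₗ[ℂ] Takiff →ₗ[ℂ] A :=
    LinearMap.mk₂ ℂ (fun x y => ρ ⁅x, y⁆ - (ρ x * ρ y - ρ y * ρ x))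
      (fun x x' y => by rw [add_lie, map_add, map_add, add_mul, mul_add]; abel)
      (fun t x y => by rw [smul_lie, map_smul, map_smul, smul_mul_assoc, mul_smul_comm]; module)
      (fun x y y' => by rw [lie_add, map_add, map_add, add_mul, mul_add]; abel)
      (fun t x y => by rw [lie_smul, map_smul, map_smul, smul_mul_assoc, mul_smul_comm]; module)
  have hB (x y : Takiff) : B x y = ρ ⁅x, y⁆ - (ρ x * ρ y - ρ y * ρ x) := rfl
  have flip {x y : Takiff} (hxy : B x y = 0) : B y x = 0 := by
    rw [hB, ← lie_skew, map_neg, ← neg_eq_zero, ← hxy, hB]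
    abel
  have self (x : Takiff) : B x x = 0 := by rw [hB, lie_self, map_zero]; abel
  have h1 : B h e = 0 := by rw [hB, he, h_lie_e, map_smul, sub_self]
  have h2 : B h eBar = 0 := by rw [hB, heb, h_lie_eBar, map_smul, sub_self]
  have h3 : B h f = 0 := by rw [hB, hf, h_lie_f, map_smul, sub_self]
  have h4 : B h fBar = 0 := by rw [hB, hfb, h_lie_fBar, map_smul, sub_self]
  have h5 : B h hBar = 0 := by rw [hB, hhb, h_lie_hBar, map_zero, sub_self]
  have h6 : B hBar e = 0 := by rw [hB, hbe, hBar_lie_e, map_smul, sub_self]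
  have h7 : B hBar f = 0 := by rw [hB, hbf, hBar_lie_f, map_smul, sub_self]
  have h8 : B hBar eBar = 0 := by rw [hB, hbeb, hBar_lie_eBar, map_zero, sub_self]
  have h9 : B hBar fBar = 0 := by rw [hB, hbfb, hBar_lie_fBar, map_zero, sub_self]
  have h10 : B e f = 0 := by rw [hB, ef, e_lie_f, sub_self]
  have h11 : B e fBar = 0 := by rw [hB, efb, e_lie_fBar, sub_self]
  have h12 : B eBar f = 0 := by rw [hB, ebf, eBar_lie_f, sub_self]
  have h13 : B eBar fBar = 0 := by rw [hB, ebfb, eBar_lie_fBar, map_zero, sub_self]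
  have h14 : B e eBar = 0 := by rw [hB, eeb, e_lie_eBar, map_zero, sub_self]
  have h15 : B f fBar = 0 := by rw [hB, ffb, f_lie_fBar, map_zero, sub_self]
  have key (x : Takiff) (k1 : B x e = 0) (k2 : B x h = 0) (k3 : B x f = 0) (k4 : B x eBar = 0)
      (k5 : B x hBar = 0) (k6 : B x fBar = 0) (y : Takiff) : B y x = 0 :=
    flip (mem_of_stdBasis (LinearMap.ker (B x)) k1 k2 k3 k4 k5 k6 y)
  refine sub_eq_zero.1 (mem_of_stdBasis (LinearMap.ker (B x)) ?_ ?_ ?_ ?_ ?_ ?_ y)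
  · exact key e (self e) (flip h1) h10 h14 (flip h6) h11 x
  · exact key h h1 (self h) h3 h2 h5 h4 x
  · exact key f (flip h10) (flip h3) (self f) (flip h12) (flip h7) h15 x
  · exact key eBar (flip h14) (flip h2) h12 (self eBar) (flip h8) h13 x
  · exact key hBar h6 (flip h5) h7 h8 (self hBar) h9 x
  · exact key fBar (flip h11) (flip h4) (flip h15) (flip h13) (flip h9) (self fBar) x

end LieHom

section Operators

open MvPolynomial

variable {R : Type} [CommRing R]

/-- Partial derivatives commute: their commutator is a derivation that vanishes on the variables. -/
lemma pderiv_comm (i j : Fin 2) (p : MvPolynomial (Fin 2) R) :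
    pderiv i (pderiv j p) = pderiv j (pderiv i p) := by
  have : ⁅(pderiv i : Derivation R (MvPolynomial (Fin 2) R) _), pderiv j⁆ = (0 : Derivation R (MvPolynomial (Fin 2) R) _) := by
    refine MvPolynomial.derivation_ext fun k => ?_
    rw [Derivation.commutator_apply]
    simp only [pderiv_X, Pi.single_apply]
    split_ifs <;> simp
  have h1 := congrArg (fun D : Derivation R (MvPolynomial (Fin 2) R) _ => D p) this
  simp only [Derivation.commutator_apply, Derivation.zero_apply] at h1
  exact sub_eq_zero.1 h1

variable (a c : R)

/-- The action of `e` on `R[s, t]`, the universal Verma module of highest weight `(a, c)`: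
`a ∂ₛ + c ∂ₜ - s ∂ₛ² - 2 t ∂ₛ ∂ₜ`. -/
def opE : Module.End R (MvPolynomial (Fin 2) R) :=
  a • (pderiv 0).toLinearMap + c • (pderiv 1).toLinearMap
    - LinearMap.mulLeft R (X 0) ∘ₗ (pderiv 0).toLinearMap ∘ₗ (pderiv 0).toLinearMap
    - (2 : R) • LinearMap.mulLeft R (X 1) ∘ₗ (pderiv 0).toLinearMap ∘ₗ (pderiv 1).toLinearMap

/-- The action of `h` on `R[s, t]`: `a - 2 s ∂ₛ - 2 t ∂ₜ`. -/
def opH : Module.End R (MvPolynomial (Fin 2) R) :=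
  a • LinearMap.id - (2 : R) • LinearMap.mulLeft R (X 0) ∘ₗ (pderiv 0).toLinearMap
    - (2 : R) • LinearMap.mulLeft R (X 1) ∘ₗ (pderiv 1).toLinearMap

/-- The action of `ē` on `R[s, t]`: `c ∂ₛ - t ∂ₛ²`. -/
def opEBar : Module.End R (MvPolynomial (Fin 2) R) :=
  c • (pderiv 0).toLinearMap
    - LinearMap.mulLeft R (X 1) ∘ₗ (pderiv 0).toLinearMap ∘ₗ (pderiv 0).toLinearMap

/-- The action of `h̄` on `R[s, t]`: `c - 2 t ∂ₛ`. -/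
def opHBar : Module.End R (MvPolynomial (Fin 2) R) :=
  c • LinearMap.id - (2 : R) • LinearMap.mulLeft R (X 1) ∘ₗ (pderiv 0).toLinearMap

/-- The action of `f` on `R[s, t]`: multiplication by `s`. -/
def opF : Module.End R (MvPolynomial (Fin 2) R) := LinearMap.mulLeft R (X 0)

/-- The action of `f̄` on `R[s, t]`: multiplication by `t`. -/
def opFBar : Module.End R (MvPolynomial (Fin 2) R) := LinearMap.mulLeft R (X 1)

variable (p : MvPolynomial (Fin 2) R)

lemma opE_apply : opE a c p = C a * pderiv 0 p + C c * pderiv 1 p - X 0 * pderiv 0 (pderiv 0 p)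
    - C 2 * (X 1 * pderiv 0 (pderiv 1 p)) := by
  change a • pderiv 0 p + c • pderiv 1 p - X 0 * pderiv 0 (pderiv 0 p)
    - (2 : R) • (X 1 * pderiv 0 (pderiv 1 p)) = _
  simp only [smul_eq_C_mul]

lemma opH_apply : opH a p = C a * p - C 2 * (X 0 * pderiv 0 p) - C 2 * (X 1 * pderiv 1 p) := by
  change a • p - (2 : R) • (X 0 * pderiv 0 p) - (2 : R) • (X 1 * pderiv 1 p) = _
  simp only [smul_eq_C_mul]

lemma opEBar_apply : opEBar c p = C c * pderiv 0 p - X 1 * pderiv 0 (pderiv 0 p) := by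
  change c • pderiv 0 p - X 1 * pderiv 0 (pderiv 0 p) = _
  simp only [smul_eq_C_mul]

lemma opHBar_apply : opHBar c p = C c * p - C 2 * (X 1 * pderiv 0 p) := by
  change c • p - (2 : R) • (X 1 * pderiv 0 p) = _
  simp only [smul_eq_C_mul]

lemma opF_apply : opF p = X 0 * p := rfl

lemma opFBar_apply : opFBar p = X 1 * p := rfl

variable [Algebra ℂ R]

/-- The representation of `𝔤` on `R[s, t]`, the universal Verma module of highest weight
`(a, c)`. -/
def polyRep : Takiff →ₗ⁅ℂ⁆ Module.End R (MvPolynomial (Fin 2) R) :=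
  { takiffLinear (opE a c) (opH a) opF (opEBar c) (opHBar c) opFBar with
    map_lie' := by
      intro x y
      have hd (t : ℂ) (q : MvPolynomial (Fin 2) R) : t • q = C (algebraMap ℂ R t) * q := by
        rw [← smul_eq_C_mul, algebraMap_smul]
      refine map_lie_of_basis _ ?_ ?_ ?_ ?_ ?_ ?_ ?_ ?_ ?_ ?_ ?_ ?_ ?_ ?_ ?_ x y
      all_goals
        simp only [takiffLinear_e, takiffLinear_h, takiffLinear_f, takiffLinear_eBar,
          takiffLinear_hBar, takiffLinear_fBar]
        refine LinearMap.ext fun p => ?_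
        simp only [LinearMap.sub_apply, Module.End.mul_apply, LinearMap.smul_apply, hd,
          LinearMap.zero_apply]
        simp only [opE_apply, opH_apply, opEBar_apply, opHBar_apply, opF_apply, opFBar_apply,
          map_add, map_sub, pderiv_mul, pderiv_C, pderiv_X_self,
          pderiv_X_of_ne (show (1 : Fin 2) ≠ 0 by decide), map_zero,
          pderiv_X_of_ne (show (0 : Fin 2) ≠ 1 by decide), pderiv_comm 1 0,
          Derivation.map_one_eq_zero]
        try simp only [map_neg, map_ofNat]
        ring }

lemma polyRep_e : polyRep a c e = opE a c := takiffLinear_e _ _ _ _ _ _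
lemma polyRep_h : polyRep a c h = opH a := takiffLinear_h _ _ _ _ _ _
lemma polyRep_f : polyRep a c f = opF := takiffLinear_f _ _ _ _ _ _
lemma polyRep_eBar : polyRep a c eBar = opEBar c := takiffLinear_eBar _ _ _ _ _ _
lemma polyRep_hBar : polyRep a c hBar = opHBar c := takiffLinear_hBar _ _ _ _ _ _
lemma polyRep_fBar : polyRep a c fBar = opFBar := takiffLinear_fBar _ _ _ _ _ _

end Operators

/-! ### A polynomial model of the induced modules -/

section Model

variable {R : Type} [CommRing R] [Algebra ℂ R] (φ : cartan →ₗ[ℂ] R) (V : ModuleCat.{0} R)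

/-- The module `R[s, t] ⊗ V`, on which `𝔤` acts by differential operators. The operators depend on
`φ`, so `φ` is a parameter of the type and determines the instance of a `U(𝔤)`-module. -/
def Model (_ : cartan →ₗ[ℂ] R) (V : ModuleCat.{0} R) : Type := MvPolynomial (Fin 2) R ⊗[R] V

instance : AddCommGroup (Model φ V) :=
  inferInstanceAs (AddCommGroup (MvPolynomial (Fin 2) R ⊗[R] V))

instance : Module R (Model φ V) := inferInstanceAs (Module R (MvPolynomial (Fin 2) R ⊗[R] V))

instance : Module ℂ (Model φ V) := inferInstanceAs (Module ℂ (MvPolynomial (Fin 2) R ⊗[R] V))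

instance : IsScalarTower ℂ R (Model φ V) :=
  inferInstanceAs (IsScalarTower ℂ R (MvPolynomial (Fin 2) R ⊗[R] V))

/-- The representation of `U(𝔤)` on `R[s, t] ⊗ V`. -/
def modelHom : U →ₐ[ℂ] Module.End R (Model φ V) :=
  ((Module.End.rTensorAlgHom R (MvPolynomial (Fin 2) R) V).restrictScalars ℂ).comp
    (UniversalEnvelopingAlgebra.lift ℂ (polyRep (φ hC) (φ hBarC)))

instance : Module U (Model φ V) := Module.compHom _ (modelHom φ V).toRingHom

lemma model_smul (u : U) (w : Model φ V) : u • w = modelHom φ V u w := rfl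

instance : IsScalarTower ℂ U (Model φ V) :=
  IsScalarTower.of_algebraMap_smul fun t w => by
    rw [model_smul, AlgHom.commutes]
    rfl

variable {V} in
/-- The pure tensor `p ⊗ v` of the polynomial model. -/
def modelTmul (p : MvPolynomial (Fin 2) R) (v : V) : Model φ V := p ⊗ₜ[R] v

lemma act_modelTmul (x : Takiff) (p : MvPolynomial (Fin 2) R) (v : V) :
    act (Model φ V) x (modelTmul φ p v) = modelTmul φ (polyRep (φ hC) (φ hBarC) x p) v := by
  rw [act_apply, model_smul]
  change (LinearMap.rTensor V (UniversalEnvelopingAlgebra.lift ℂ (polyRep (φ hC) (φ hBarC))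
    (UniversalEnvelopingAlgebra.ι ℂ x)) : _) (p ⊗ₜ[R] v) = _
  rw [UniversalEnvelopingAlgebra.lift_ι_apply]
  rfl

lemma modelTmul_C (r : R) (v : V) : modelTmul φ (MvPolynomial.C r) v = modelTmul φ 1 (r • v) := by
  change _ ⊗ₜ[R] _ = _ ⊗ₜ[R] _
  rw [← TensorProduct.smul_tmul, MvPolynomial.smul_eq_C_mul, mul_one]

lemma modelTmul_add (p q : MvPolynomial (Fin 2) R) (v : V) :
    modelTmul φ (p + q) v = modelTmul φ p v + modelTmul φ q v := TensorProduct.add_tmul _ _ _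

/-- The inclusion of `V` as the constants. -/
def constants : V →ₗ[ℂ] Model φ V where
  toFun v := modelTmul φ 1 v
  map_add' v w := TensorProduct.tmul_add _ _ _
  map_smul' t v := by
    change (1 : MvPolynomial (Fin 2) R) ⊗ₜ[R] (t • v) = t • ((1 : MvPolynomial (Fin 2) R) ⊗ₜ[R] v)
    rw [← algebraMap_smul R t v, TensorProduct.tmul_smul, algebraMap_smul]

lemma constants_injective : Function.Injective (constants φ V) := by
  let G : MvPolynomial (Fin 2) R ⊗[R] V →ₗ[R] V := (TensorProduct.lid R V).toLinearMap ∘ₗ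
    LinearMap.rTensor V (MvPolynomial.aeval fun _ => (0 : R)).toLinearMap
  have key (v : V) : G ((1 : MvPolynomial (Fin 2) R) ⊗ₜ[R] v) = v := by simp [G]
  intro v w hvw
  exact (key v).symm.trans ((congrArg G hvw).trans (key w))

lemma act_e_constants (v : V) : act _ e (constants φ V v) = 0 := by
  refine (act_modelTmul φ V e 1 v).trans ?_
  rw [polyRep_e, opE_apply]
  simp
  exact TensorProduct.zero_tmul _ _

lemma act_eBar_constants (v : V) : act _ eBar (constants φ V v) = 0 := by
  refine (act_modelTmul φ V eBar 1 v).trans ?_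
  rw [polyRep_eBar, opEBar_apply]
  simp
  exact TensorProduct.zero_tmul _ _

lemma act_h_constants (v : V) : act _ h (constants φ V v) = constants φ V (φ hC • v) := by
  refine (act_modelTmul φ V h 1 v).trans ?_
  rw [polyRep_h, opH_apply]
  simp only [mul_one, Derivation.map_one_eq_zero, mul_zero, sub_zero]
  exact modelTmul_C φ V _ v

lemma act_hBar_constants (v : V) :
    act _ hBar (constants φ V v) = constants φ V (φ hBarC • v) := by
  refine (act_modelTmul φ V hBar 1 v).trans ?_
  rw [polyRep_hBar, opHBar_apply]
  simp only [mul_one, Derivation.map_one_eq_zero, mul_zero, sub_zero]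
  exact modelTmul_C φ V _ v

/-- The constants generate the polynomial model under `f` and `f̄`. -/
lemma model_induction (T : Submodule ℂ (Model φ V)) (h1 : ∀ v, constants φ V v ∈ T)
    (hf : ∀ w ∈ T, act _ f w ∈ T) (hfb : ∀ w ∈ T, act _ fBar w ∈ T) (w : Model φ V) : w ∈ T := by
  have key (p : MvPolynomial (Fin 2) R) (v : V) : modelTmul φ p v ∈ T := by
    induction p using MvPolynomial.induction_on with
    | C r => rw [modelTmul_C]; exact h1 _
    | add p q hp hq => rw [modelTmul_add]; exact add_mem hp hq
    | mul_X p i hp =>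
      fin_cases i
      · have := hf _ hp
        rw [act_modelTmul, polyRep_f, opF_apply, mul_comm] at this
        exact this
      · have := hfb _ hp
        rw [act_modelTmul, polyRep_fBar, opFBar_apply, mul_comm] at this
        exact this
  change (w : MvPolynomial (Fin 2) R ⊗[R] V) ∈ _ at *
  induction w using TensorProduct.induction_on with
  | zero => exact Submodule.zero_mem _
  | tmul p v => exact key p v
  | add x y hx hy => exact Submodule.add_mem _ hx hy

/-- A linear map out of the polynomial model is `U(𝔤)`-linear if it commutes with `f` and `f̄`, and
with all of `𝔤` on the constants. -/
lemma model_map_smul {M : Type} [AddCommGroup M] [Module U M] [Module ℂ M] [IsScalarTower ℂ U M]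
    (g : Model φ V →ₗ[ℂ] M) (hf : ∀ w, g (act _ f w) = act M f (g w))
    (hfb : ∀ w, g (act _ fBar w) = act M fBar (g w))
    (h1 : ∀ x v, g (act _ x (constants φ V v)) = act M x (g (constants φ V v)))
    (u : U) (w : Model φ V) : g (u • w) = u • g w := by
  refine map_smul_of_lie g (fun x w => ?_) u w
  let T : Submodule ℂ (Model φ V) :=
    { carrier := {w | ∀ x, g (act _ x w) = act M x (g w)}
      add_mem' := fun ha hb x => by rw [map_add, map_add, ha, hb, map_add, map_add]
      zero_mem' := fun x => by simp
      smul_mem' := fun t m hm x => by rw [map_smul, map_smul, hm, map_smul, map_smul] }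
  -- If `g` commutes with `y`, then `T` is stable under `y`, because
  -- `x y w = y x w + [x, y] w` both before and after applying `g`.
  have step (y : Takiff) (hy : ∀ w, g (act _ y w) = act M y (g w)) (w) (hw : w ∈ T) :
      act _ y w ∈ T := by
    intro x
    rw [act_comm, map_add, hy, hw, hw, hy, act_comm x y]
  exact model_induction φ V T (fun v x => h1 x v) (step f hf) (step fBar hfb) w x

end Model

/-! ### The Poincaré–Birkhoff–Witt decomposition of induced modules -/

section PBW

variable {R : Type} [CommRing R] [Algebra ℂ R] (φ : cartan →ₗ[ℂ] R) (V : ModuleCat.{0} R)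

/-- The map from the induced module to its polynomial model. -/
def indToModel : (parabolicInd φ).obj V →ₗ[U] Model φ V :=
  indLift φ V (constants φ V) (act_e_constants φ V) (act_eBar_constants φ V)
    (act_h_constants φ V) (act_hBar_constants φ V)

lemma indToModel_indMk (v : V) : indToModel φ V (indMk φ V v) = constants φ V v :=
  indLift_indMk φ V _ _ _ _ _ v

lemma indMk_injective : Function.Injective (indMk φ V) := by
  intro v w hvw
  refine constants_injective φ V ?_
  rw [← indToModel_indMk, hvw, indToModel_indMk]

/-- The polynomial model as a space of functions with values in `V`. -/
def modelEquiv : Model φ V ≃ₗ[R] ((Fin 2 →₀ ℕ) →₀ V) :=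
  (TensorProduct.congr (MvPolynomial.basisMonomials (Fin 2) R).repr (LinearEquiv.refl R V)).trans
    (TensorProduct.finsuppScalarLeft R V (Fin 2 →₀ ℕ))

lemma modelEquiv_monomial (d : Fin 2 →₀ ℕ) (r : R) (v : V) :
    modelEquiv φ V (modelTmul φ (MvPolynomial.monomial d r) v) = Finsupp.single d (r • v) := by
  change TensorProduct.finsuppScalarLeft R V (Fin 2 →₀ ℕ) (TensorProduct.congr
    (MvPolynomial.basisMonomials (Fin 2) R).repr (LinearEquiv.refl R V)
      (MvPolynomial.monomial d r ⊗ₜ[R] v)) = _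
  have : (MvPolynomial.basisMonomials (Fin 2) R).repr (MvPolynomial.monomial d r) =
      Finsupp.single d r := rfl
  rw [TensorProduct.congr_tmul, this, LinearEquiv.refl_apply,
    TensorProduct.finsuppScalarLeft_apply_tmul, Finsupp.sum_single_index (by simp)]

/-- The map `sⁱ tʲ ⊗ v ↦ fⁱ f̄ʲ ⊗ v` from the polynomial model to the induced module. -/
def modelToInd : Model φ V →ₗ[ℂ] (parabolicInd φ).obj V :=
  Finsupp.lsum ℂ (fun d : Fin 2 →₀ ℕ =>
    (act ((parabolicInd φ).obj V) f ^ d 0 * act ((parabolicInd φ).obj V) fBar ^ d 1) ∘ₗ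
      indMk φ V) ∘ₗ (modelEquiv φ V).toLinearMap.restrictScalars ℂ

lemma modelToInd_monomial (d : Fin 2 →₀ ℕ) (r : R) (v : V) :
    modelToInd φ V (modelTmul φ (MvPolynomial.monomial d r) v) =
      (act ((parabolicInd φ).obj V) f ^ d 0) ((act ((parabolicInd φ).obj V) fBar ^ d 1)
        (indMk φ V (r • v))) := by
  refine (congrArg (Finsupp.lsum ℂ _) (modelEquiv_monomial φ V d r v)).trans ?_
  rw [Finsupp.lsum_single]
  rfl

lemma modelToInd_constants (v : V) : modelToInd φ V (constants φ V v) = indMk φ V v := by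
  refine (modelToInd_monomial φ V 0 1 v).trans ?_
  simp

lemma model_ext_monomial {M : Type} [AddCommGroup M] [Module ℂ M] {g g' : Model φ V →ₗ[ℂ] M}
    (hg : ∀ d r v, g (modelTmul φ (MvPolynomial.monomial d r) v) =
      g' (modelTmul φ (MvPolynomial.monomial d r) v)) : g = g' := by
  have key (p : MvPolynomial (Fin 2) R) (v : V) : g (modelTmul φ p v) = g' (modelTmul φ p v) := by
    induction p using MvPolynomial.induction_on' with
    | monomial d r => exact hg d r v
    | add p q hp hq => rw [modelTmul_add, map_add, map_add, hp, hq]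
  refine LinearMap.ext fun w => ?_
  change (w : MvPolynomial (Fin 2) R ⊗[R] V) ∈ LinearMap.eqLocus g g'
  induction w using TensorProduct.induction_on with
  | zero => exact Submodule.zero_mem _
  | tmul p v => exact key p v
  | add x y hx hy => exact Submodule.add_mem _ hx hy

lemma modelToInd_f (w : Model φ V) :
    modelToInd φ V (act _ f w) = act _ f (modelToInd φ V w) := by
  refine LinearMap.congr_fun (f := modelToInd φ V ∘ₗ act _ f)
    (g := act _ f ∘ₗ modelToInd φ V) (model_ext_monomial φ V fun d r v => ?_) w
  rw [LinearMap.comp_apply, LinearMap.comp_apply, act_modelTmul, polyRep_f, opF_apply,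
    MvPolynomial.X, MvPolynomial.monomial_mul, modelToInd_monomial, modelToInd_monomial]
  simp [add_comm 1, pow_succ']

lemma modelToInd_fBar (w : Model φ V) :
    modelToInd φ V (act _ fBar w) = act _ fBar (modelToInd φ V w) := by
  refine LinearMap.congr_fun (f := modelToInd φ V ∘ₗ act _ fBar)
    (g := act _ fBar ∘ₗ modelToInd φ V) (model_ext_monomial φ V fun d r v => ?_) w
  have hc : Commute (act ((parabolicInd φ).obj V) fBar) (act ((parabolicInd φ).obj V) f) :=
    LinearMap.ext act_fBar_f
  rw [LinearMap.comp_apply, LinearMap.comp_apply, act_modelTmul, polyRep_fBar, opFBar_apply,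
    MvPolynomial.X, MvPolynomial.monomial_mul, modelToInd_monomial, modelToInd_monomial,
    ← Module.End.mul_apply (act _ fBar), (hc.pow_right _).eq]
  simp [add_comm 1, pow_succ']

lemma modelToInd_smul (u : U) (w : Model φ V) :
    modelToInd φ V (u • w) = u • modelToInd φ V w := by
  refine model_map_smul φ V _ (modelToInd_f φ V) (modelToInd_fBar φ V) (fun x v => ?_) u w
  have hx : x ∈ LinearMap.eqLocus (modelToInd φ V ∘ₗ (act (Model φ V)).flip (constants φ V v))
      ((act _).flip (modelToInd φ V (constants φ V v))) := by
    refine mem_of_stdBasis _ ?_ ?_ ?_ ?_ ?_ ?_ x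
    · change modelToInd φ V (act _ e _) = act _ e _
      rw [act_e_constants, modelToInd_constants, act_e_indMk, map_zero]
    · change modelToInd φ V (act _ h _) = act _ h _
      rw [act_h_constants, modelToInd_constants, modelToInd_constants, act_h_indMk]
    · exact modelToInd_f φ V _
    · change modelToInd φ V (act _ eBar _) = act _ eBar _
      rw [act_eBar_constants, modelToInd_constants, act_eBar_indMk, map_zero]
    · change modelToInd φ V (act _ hBar _) = act _ hBar _
      rw [act_hBar_constants, modelToInd_constants, modelToInd_constants, act_hBar_indMk]
    · exact modelToInd_fBar φ V _
  exact hx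

lemma modelToInd_surjective : Function.Surjective (modelToInd φ V) := by
  let g : Model φ V →ₗ[U] (parabolicInd φ).obj V :=
    { toFun := modelToInd φ V
      map_add' := map_add _
      map_smul' := modelToInd_smul φ V }
  have : LinearMap.range g = ⊤ := by
    refine eq_top_iff.2 ((span_range_indMk φ V).ge.trans (Submodule.span_le.2 ?_))
    rintro _ ⟨v, rfl⟩
    exact ⟨constants φ V v, modelToInd_constants φ V v⟩
  exact (LinearMap.range_eq_top (f := g)).1 this

/-- The induced module is generated by `1 ⊗ V` under `f` and `f̄`. -/
lemma ind_induction (T : Submodule ℂ ((parabolicInd φ).obj V)) (h1 : ∀ v, indMk φ V v ∈ T)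
    (hf : ∀ w ∈ T, act _ f w ∈ T) (hfb : ∀ w ∈ T, act _ fBar w ∈ T)
    (w : (parabolicInd φ).obj V) : w ∈ T := by
  obtain ⟨w, rfl⟩ := modelToInd_surjective φ V w
  refine model_induction φ V (T.comap (modelToInd φ V)) (fun v => ?_) (fun w hw => ?_)
    (fun w hw => ?_) w
  · rw [Submodule.mem_comap, modelToInd_constants]; exact h1 v
  · rw [Submodule.mem_comap, modelToInd_f]; exact hf _ hw
  · rw [Submodule.mem_comap, modelToInd_fBar]; exact hfb _ hw

variable {φ V} {a : ℂ}

/-- The induced module is the sum of `1 ⊗ V` and the generalized weight spaces `a - 2k` with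
`k ≥ 1`. -/
lemma sup_weights_eq_top (hV : ∀ v : V, v ∈ (Algebra.lsmul ℂ ℂ V (φ hC)).maxGenEigenspace a) :
    LinearMap.range (indMk φ V) ⊔ ⨆ k : ℕ,
      (act ((parabolicInd φ).obj V) h).maxGenEigenspace (a + -2 * (k + 1)) = ⊤ := by
  have h0 (v : V) : indMk φ V v ∈ (act ((parabolicInd φ).obj V) h).maxGenEigenspace a :=
    map_mem_maxGenEigenspace (indMk φ V) a (fun v => (act_h_indMk φ V v).symm) (hV v)
  let T := LinearMap.range (indMk φ V) ⊔
    ⨆ k : ℕ, (act ((parabolicInd φ).obj V) h).maxGenEigenspace (a + -2 * (k + 1))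
  have step (y : Takiff) (hy : ⁅h, y⁆ = (-2 : ℂ) • y) : T ≤ T.comap (act _ y) := by
    refine sup_le ?_ (iSup_le fun k => ?_)
    · rintro _ ⟨v, rfl⟩
      refine Submodule.mem_sup_right (Submodule.mem_iSup_of_mem 0 ?_)
      simpa using act_mem_maxGenEigenspace hy (h0 v)
    · intro w hw
      refine Submodule.mem_sup_right (Submodule.mem_iSup_of_mem (k + 1) ?_)
      convert act_mem_maxGenEigenspace hy hw using 2
      push_cast
      ring
  exact eq_top_iff.2 fun w _ => ind_induction φ V _
    (fun v => Submodule.mem_sup_left (LinearMap.mem_range_self _ v)) (step f h_lie_f) (step fBar h_lie_fBar) w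

/-- The generalized weight space of highest weight is `1 ⊗ V`. -/
lemma mem_range_indMk (hV : ∀ v : V, v ∈ (Algebra.lsmul ℂ ℂ V (φ hC)).maxGenEigenspace a)
    {w : (parabolicInd φ).obj V} (hw : w ∈ (act _ h).maxGenEigenspace a) :
    w ∈ LinearMap.range (indMk φ V) := by
  have hw' : w ∈ LinearMap.range (indMk φ V) ⊔ ⨆ k : ℕ,
      (act ((parabolicInd φ).obj V) h).maxGenEigenspace (a + -2 * (k + 1)) :=
    (sup_weights_eq_top hV).symm ▸ Submodule.mem_top
  obtain ⟨_, ⟨v, rfl⟩, z, hz, rfl⟩ := Submodule.mem_sup.1 hw'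
  have h0 : indMk φ V v ∈ (act ((parabolicInd φ).obj V) h).maxGenEigenspace a :=
    map_mem_maxGenEigenspace (indMk φ V) a (fun v => (act_h_indMk φ V v).symm) (hV v)
  have hza : z ∈ (act ((parabolicInd φ).obj V) h).maxGenEigenspace a := by
    simpa using sub_mem hw h0
  have : z = 0 := by
    refine eq_zero_of_mem_iSup_maxGenEigenspace (fun _ => le_rfl) (fun k hk => ?_) hza hz
    have : (-2 * (k + 1) : ℂ) = 0 := by linear_combination hk
    have h2 : ((k : ℂ) + 1) ≠ 0 := Nat.cast_add_one_ne_zero k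
    simp [h2] at this
  rw [this, add_zero]
  exact ⟨v, rfl⟩

/-- The weights of an induced module are `a - 2k`. -/
lemma exists_weight_eq (hV : ∀ v : V, v ∈ (Algebra.lsmul ℂ ℂ V (φ hC)).maxGenEigenspace a)
    {b : ℂ} {w : (parabolicInd φ).obj V} (hw : w ∈ (act _ h).maxGenEigenspace b) (hw0 : w ≠ 0) :
    ∃ k : ℕ, b = a + -2 * k := by
  by_contra! hb
  have htop : ⨆ k : ℕ, (act ((parabolicInd φ).obj V) h).maxGenEigenspace (a + -2 * k) = ⊤ := by
    refine eq_top_iff.2 ((sup_weights_eq_top hV).ge.trans (sup_le ?_ (iSup_le fun k => ?_)))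
    · rintro _ ⟨v, rfl⟩
      refine Submodule.mem_iSup_of_mem 0 ?_
      have := map_mem_maxGenEigenspace (indMk φ V) a (fun v => (act_h_indMk φ V v).symm) (hV v)
      simpa using this
    · refine le_iSup_of_le (k + 1) (le_of_eq ?_)
      push_cast
      rfl
  exact hw0 (eq_zero_of_mem_iSup_maxGenEigenspace (fun _ => le_rfl) (fun k => (hb k).symm) hw
    (htop.symm ▸ Submodule.mem_top))

end PBW

/-! ### Highest weight vectors in induced modules and simple subquotients -/

section Radical

variable {R : Type} [CommRing R] [Algebra ℂ R] {V : Type} [AddCommGroup V] [Module R V]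
  [Module ℂ V] [IsScalarTower ℂ R V]

/-- Generalized eigenvectors of `r` in terms of the annihilator of the vector. -/
lemma mem_maxGenEigenspace_lsmul (r : R) (t : ℂ) (v : V) :
    v ∈ (Algebra.lsmul ℂ ℂ V r).maxGenEigenspace t ↔
      r - algebraMap ℂ R t ∈ (Ideal.torsionOf R V v).radical := by
  have key (k : ℕ) : ((Algebra.lsmul ℂ ℂ V r - t • 1) ^ k) v =
      (r - algebraMap ℂ R t) ^ k • v := by
    have : Algebra.lsmul ℂ ℂ V r - t • 1 = Algebra.lsmul ℂ ℂ V (r - algebraMap ℂ R t) := by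
      ext w
      simp
    rw [this, ← map_pow]
    rfl
  simp only [Module.End.mem_maxGenEigenspace, key]
  rfl

end Radical

section InducedBlock

variable {R : Type} [CommRing R] [Algebra ℂ R]

/-- A finite-dimensional `R`-module `V` on which `h` and `h̄`, acting through `φ`, have only the
generalized eigenvalues `a` and `c`. -/
structure HasWeight (φ : cartan →ₗ[ℂ] R) (V : ModuleCat.{0} R) (a c : ℂ) : Prop where
  finite : Module.Finite ℂ V
  h (v : V) : v ∈ (Algebra.lsmul ℂ ℂ V (φ hC)).maxGenEigenspace a
  hBar (v : V) : v ∈ (Algebra.lsmul ℂ ℂ V (φ hBarC)).maxGenEigenspace c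

variable {φ : cartan →ₗ[ℂ] R} {V : ModuleCat.{0} R} {a c : ℂ}

lemma HasWeight.borelFinite (hV : HasWeight φ V a c) (v : V) : BorelFinite (indMk φ V v) := by
  have := hV.finite
  refine ⟨LinearMap.range (indMk φ V), LinearMap.mem_range_self _ v, inferInstance, ?_⟩
  rintro x hx _ ⟨w, rfl⟩
  rw [act_indMk_of_mem_borel φ V hx]
  exact LinearMap.mem_range_self _ _

lemma HasWeight.isBlockLike (hV : HasWeight φ V a c) :
    IsBlockLike ((parabolicInd φ).obj V) a c := by
  refine IsBlockLike.of_generators _ (span_range_indMk φ V) ?_ ?_ ?_ <;> rintro _ ⟨v, rfl⟩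
  · exact map_mem_maxGenEigenspace (indMk φ V) c (fun v => (act_hBar_indMk φ V v).symm)
      (hV.hBar v)
  · refine map_mem_maxGenEigenspace (A := Algebra.lsmul ℂ ℂ V (φ hC * φ hBarC + 2 * φ hBarC))
      (indMk φ V) _ (fun v => ?_) ?_
    · rw [casimir_apply, act_e_indMk, act_eBar_indMk, act_hBar_indMk, act_h_indMk, map_zero,
        map_zero, smul_zero, add_zero, add_zero, ← map_smul, ← map_add]
      congr 1
      change (φ hC * φ hBarC + 2 * φ hBarC) • v = _
      rw [add_smul, mul_smul, mul_smul, ofNat_smul_eq_nsmul R,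
        ofNat_smul_eq_nsmul ℂ]
    · have h1 := (mem_maxGenEigenspace_lsmul _ _ _).1 (hV.h v)
      have h2 := (mem_maxGenEigenspace_lsmul _ _ _).1 (hV.hBar v)
      rw [mem_maxGenEigenspace_lsmul]
      convert add_mem (Ideal.mul_mem_right (φ hBarC) _ h1)
        (Ideal.mul_mem_left _ (algebraMap ℂ R (a + 2)) h2) using 1
      simp only [map_mul, map_add, map_ofNat]
      ring
  · exact hV.borelFinite v

lemma HasWeight.finite_ind (hV : HasWeight φ V a c) :
    Module.Finite U ((parabolicInd φ).obj V) := by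
  have := hV.finite
  obtain ⟨s, hs⟩ := (Module.finite_def (R := ℂ) (M := V)).1 inferInstance
  have hle : Submodule.span U (indMk φ V '' s) = ⊤ := by
    refine eq_top_iff.2 ((span_range_indMk φ V).ge.trans (Submodule.span_le.2 ?_))
    rintro _ ⟨v, rfl⟩
    have hv : v ∈ Submodule.span ℂ (s : Set V) := hs ▸ Submodule.mem_top
    induction hv using Submodule.span_induction with
    | mem v hv => exact Submodule.subset_span ⟨v, hv, rfl⟩
    | zero => rw [map_zero]; exact zero_mem _
    | add v w _ _ h1 h2 => rw [map_add]; exact add_mem h1 h2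
    | smul t v _ h1 =>
      rw [map_smul, ← algebraMap_smul U]
      exact Submodule.smul_mem _ _ h1
  exact ⟨hle ▸ Submodule.fg_span (s.finite_toSet.image _)⟩

/-- If `h` acts on `V` by a scalar, then it acts diagonalizably on the induced module. -/
lemma iSup_eigenspace_ind (hh : ∀ v : V, φ hC • v = a • v) :
    ⨆ b : ℂ, (act ((parabolicInd φ).obj V) h).eigenspace b = ⊤ := by
  let T := ⨆ b : ℂ, (act ((parabolicInd φ).obj V) TakiffSl2.h).eigenspace b
  have step (y : Takiff) (hy : ⁅TakiffSl2.h, y⁆ = (-2 : ℂ) • y) : T ≤ T.comap (act _ y) := by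
    refine iSup_le fun b w hw => Submodule.mem_iSup_of_mem (b + -2) ?_
    rw [Module.End.mem_eigenspace_iff] at hw ⊢
    rw [act_comm, hw, hy, map_smul, map_smul, LinearMap.smul_apply, add_smul]
  refine eq_top_iff.2 fun w _ => ind_induction φ V T (fun v => ?_) (step f h_lie_f)
    (step fBar h_lie_fBar) w
  refine Submodule.mem_iSup_of_mem a (Module.End.mem_eigenspace_iff.2 ?_)
  rw [act_h_indMk, hh, map_smul]

/-- An intertwiner out of an induced module is injective if it is injective on `1 ⊗ V`: otherwise
its kernel has a highest weight vector, which by the Casimir operator lies in `1 ⊗ V`. -/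
lemma HasWeight.injective_of_injective (hV : HasWeight φ V a c) (hc : c ≠ 0)
    {M : Type} [AddCommGroup M] [Module U M] (g : (parabolicInd φ).obj V →ₗ[U] M)
    (hg : ∀ v, g (indMk φ V v) = 0 → v = 0) : Function.Injective g := by
  rw [← LinearMap.ker_eq_bot]
  by_contra hne
  have := (Submodule.nontrivial_iff_ne_bot).2 hne
  have hK : IsBlockLike (LinearMap.ker g) a c :=
    hV.isBlockLike.of_injective (LinearMap.ker g).subtype Subtype.val_injective
  obtain ⟨w, hw, hhw⟩ := hK.exists_isHighest hc
  obtain ⟨v, hv⟩ := mem_range_indMk hV.h (w := (w : (parabolicInd φ).obj V))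
    (Module.End.eigenspace_le_maxGenEigenspace (Module.End.mem_eigenspace_iff.2
      (hhw.map (LinearMap.ker g).subtype).h))
  have h0 : v = 0 := hg v (by rw [hv]; exact w.2)
  rw [h0, map_zero] at hv
  exact hw (Subtype.ext hv.symm)

end InducedBlock

section Verma

variable {μ : Weight}

lemma hasWeight_verma (μ : Weight) :
    HasWeight μ (ModuleCat.of ℂ ℂ) (μ hC) (μ hBarC) where
  finite := inferInstanceAs (Module.Finite ℂ ℂ)
  h v := by
    rw [mem_maxGenEigenspace_lsmul]
    simp
  hBar v := by
    rw [mem_maxGenEigenspace_lsmul]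
    simp

/-- The canonical generator of the Verma module. -/
def vermaGen (μ : Weight) : verma μ := indMk μ (ModuleCat.of ℂ ℂ) (1 : ℂ)

lemma indMk_verma (μ : Weight) (t : ℂ) :
    indMk μ (ModuleCat.of ℂ ℂ) t = t • vermaGen μ := by
  exact (congrArg (indMk μ (ModuleCat.of ℂ ℂ)) (mul_one t).symm).trans
    ((indMk μ (ModuleCat.of ℂ ℂ)).map_smul t (1 : ℂ))

lemma vermaGen_ne_zero (μ : Weight) : vermaGen μ ≠ 0 := by
  intro h0
  exact one_ne_zero (α := ℂ) (indMk_injective μ (ModuleCat.of ℂ ℂ) (h0.trans (map_zero _).symm))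

lemma span_vermaGen (μ : Weight) : Submodule.span U {vermaGen μ} = ⊤ := by
  refine eq_top_iff.2 ((span_range_indMk μ (ModuleCat.of ℂ ℂ)).ge.trans (Submodule.span_le.2 ?_))
  rintro _ ⟨t, rfl⟩
  have ht : (t : ℂ) • vermaGen μ ∈ Submodule.span U {vermaGen μ} := by
    rw [← algebraMap_smul U]
    exact Submodule.smul_mem _ _ (Submodule.mem_span_singleton_self _)
  rw [← indMk_verma] at ht
  exact ht

/-- The Verma module `Δ(μ)` is simple if `μ(h̄) ≠ 0`. -/
lemma isSimpleModule_verma (hμ : μ hBarC ≠ 0) : IsSimpleModule U (verma μ) := by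
  have : Nontrivial (verma μ) := ⟨_, _, vermaGen_ne_zero μ⟩
  have : Nontrivial (Submodule U (verma μ)) := inferInstance
  rw [isSimpleModule_iff]
  refine ⟨fun N => or_iff_not_imp_left.2 fun hN => ?_⟩
  have hinj : ¬ Function.Injective N.mkQ := by
    intro hi
    rw [← LinearMap.ker_eq_bot, Submodule.ker_mkQ] at hi
    exact hN hi
  have : ∃ v, N.mkQ (indMk μ (ModuleCat.of ℂ ℂ) v) = 0 ∧ v ≠ 0 := by
    by_contra! hv
    exact hinj ((hasWeight_verma μ).injective_of_injective hμ N.mkQ hv)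
  obtain ⟨t, ht, ht0⟩ := this
  have ht' : t • vermaGen μ ∈ N := by
    rw [← indMk_verma]
    exact (Submodule.Quotient.mk_eq_zero N).1 ht
  have hg : vermaGen μ ∈ N := by
    have := N.smul_mem (algebraMap ℂ U (t : ℂ)⁻¹) ht'
    rwa [algebraMap_smul, smul_smul, inv_mul_cancel₀ ht0, one_smul] at this
  exact eq_top_iff.2 ((span_vermaGen μ).ge.trans
    (Submodule.span_le.2 (Set.singleton_subset_iff.2 hg)))

/-- For `μ(h̄) ≠ 0`, the simple module `L(μ)` is the Verma module. -/
lemma nonempty_verma_equiv_simpleL (hμ : μ hBarC ≠ 0) :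
    Nonempty (verma μ ≃ₗ[U] simpleL μ) := by
  have := isSimpleModule_verma hμ
  have h0 : Module.jacobson U (verma μ) = ⊥ := IsSemisimpleModule.jacobson_eq_bot U _
  exact ⟨(Submodule.quotEquivOfEqBot _ h0).symm⟩

/-- The universal property of the Verma module. -/
lemma exists_verma_hom {M : Type} [AddCommGroup M] [Module U M] [Module ℂ M]
    [IsScalarTower ℂ U M] {w : M} (hw : IsHighest (μ hC) (μ hBarC) w) :
    ∃ g : verma μ →ₗ[U] M, g (vermaGen μ) = w := by
  let k : (ModuleCat.of ℂ ℂ : ModuleCat.{0} ℂ) →ₗ[ℂ] M := LinearMap.toSpanSingleton ℂ M w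
  have hk (t : ℂ) : k t = t • w := rfl
  refine ⟨indLift μ (ModuleCat.of ℂ ℂ) k (fun t : ℂ => ?_) (fun t : ℂ => ?_) (fun t : ℂ => ?_)
    (fun t : ℂ => ?_), ?_⟩
  · rw [hk, map_smul, hw.e, smul_zero]
  · rw [hk, map_smul, hw.eBar, smul_zero]
  · rw [hk, map_smul, hw.h]
    refine Eq.trans ?_ (hk (μ hC * t)).symm
    module
  · rw [hk, map_smul, hw.hBar]
    refine Eq.trans ?_ (hk (μ hBarC * t)).symm
    module
  · refine (indLift_indMk μ (ModuleCat.of ℂ ℂ) k _ _ _ _ (1 : ℂ)).trans ?_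
    exact one_smul _ _

/-- A simple block-like module is isomorphic to `L(μ)`, as its highest weight vector gives a nonzero
homomorphism from the simple module `Δ(μ)`. -/
lemma nonempty_equiv_simpleL (hμ : μ hBarC ≠ 0) {S : Type} [AddCommGroup S] [Module U S]
    [Module ℂ S] [IsScalarTower ℂ U S] [IsSimpleModule U S]
    (hS : IsBlockLike S (μ hC) (μ hBarC)) : Nonempty (S ≃ₗ[U] simpleL μ) := by
  have := isSimpleModule_verma hμ
  have := IsSimpleModule.nontrivial U S
  obtain ⟨w, hw, hhw⟩ := hS.exists_isHighest hμ
  obtain ⟨g, hg⟩ := exists_verma_hom hhw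
  have hb := LinearMap.bijective_of_ne_zero (f := g) (fun h0 => hw (by rw [← hg, h0]; rfl))
  obtain ⟨E⟩ := nonempty_verma_equiv_simpleL hμ
  exact ⟨(LinearEquiv.ofBijective g hb).symm.trans E⟩

end Verma

/-! ### The structure of modules in a block -/

section Block

variable {M : Type} [AddCommGroup M] [Module U M]

variable (M) in
/-- All simple subquotients of `M` are isomorphic to `L(μ)`. -/
def SimpleSubquotients (μ : Weight) : Prop :=
  ∀ (N : Submodule U M) (P : Submodule U N),
    IsSimpleModule U (N ⧸ P) → Nonempty ((N ⧸ P) ≃ₗ[U] simpleL μ)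

variable {μ : Weight}

/-- If `T` is a proper submodule of a finitely generated submodule `N` of `M`, then `N` has `Δ(μ)`
as a quotient by a submodule that contains `T`. -/
lemma SimpleSubquotients.exists_hom (hM : SimpleSubquotients M μ) (hμ : μ hBarC ≠ 0)
    (N : Submodule U M) [Module.Finite U N] (T : Submodule U N) (hT : T ≠ ⊤) :
    ∃ g : N →ₗ[U] verma μ, Function.Surjective g ∧ ∀ n ∈ T, g n = 0 := by
  obtain ⟨P, hP, hTP⟩ := (eq_top_or_exists_le_coatom T).resolve_left hT
  obtain ⟨E⟩ := hM N P (isSimpleModule_iff_isCoatom.2 hP)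
  obtain ⟨E'⟩ := nonempty_verma_equiv_simpleL hμ
  refine ⟨(E.trans E'.symm).toLinearMap ∘ₗ P.mkQ,
    (E.trans E'.symm).surjective.comp P.mkQ_surjective, fun n hn => ?_⟩
  change (E.trans E'.symm) (P.mkQ n) = 0
  rw [Submodule.mkQ_apply, (Submodule.Quotient.mk_eq_zero P).2 (hTP hn), map_zero]

/-- A nonzero vector lies in a submodule with a homomorphism to `Δ(μ)` that does not kill it. -/
lemma SimpleSubquotients.exists_hom_ne_zero (hM : SimpleSubquotients M μ) (hμ : μ hBarC ≠ 0)
    {v : M} (hv : v ≠ 0) : ∃ (N : Submodule U M) (w : N) (g : N →ₗ[U] verma μ),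
      (w : M) = v ∧ g w ≠ 0 := by
  let w : Submodule.span U {v} := ⟨v, Submodule.mem_span_singleton_self v⟩
  have : Module.Finite U (Submodule.span U {v}) :=
    Module.Finite.iff_fg.2 (Submodule.fg_span_singleton v)
  have : Nontrivial (Submodule.span U {v}) :=
    ⟨w, 0, fun h0 => hv (congrArg Subtype.val h0)⟩
  obtain ⟨g, hg, -⟩ := hM.exists_hom hμ (Submodule.span U {v}) ⊥ bot_ne_top
  refine ⟨_, w, g, rfl, fun h0 => ?_⟩
  obtain ⟨⟨n, hn⟩, hgn⟩ := hg (vermaGen μ)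
  obtain ⟨u, rfl⟩ := Submodule.mem_span_singleton.1 hn
  have : g (u • w) = vermaGen μ := hgn
  rw [map_smul, h0, smul_zero] at this
  exact vermaGen_ne_zero μ this.symm

variable [Module ℂ M] [IsScalarTower ℂ U M]

/-- The weights of a module in the block are weights of `Δ(μ)`. -/
lemma SimpleSubquotients.weight (hM : SimpleSubquotients M μ) (hμ : μ hBarC ≠ 0)
    {v : M} (hv : v ≠ 0) {b : ℂ} (hb : v ∈ (act M h).maxGenEigenspace b) :
    ∃ k : ℕ, b = μ hC + -2 * k := by
  obtain ⟨N, w, g, rfl, hg⟩ := hM.exists_hom_ne_zero hμ hv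
  have hw : w ∈ (act N h).maxGenEigenspace b :=
    mem_maxGenEigenspace_of_map (N.subtype.restrictScalars ℂ) b (fun _ => rfl)
      Subtype.val_injective hb
  exact exists_weight_eq (hasWeight_verma μ).h (map_mem_maxGenEigenspace (B := act (verma μ) h)
    (g.restrictScalars ℂ) b (fun v => map_act g h v) hw) hg

/-- The generalized weight space of highest weight is killed by `e` and `ē`. -/
lemma SimpleSubquotients.act_eq_zero (hM : SimpleSubquotients M μ) (hμ : μ hBarC ≠ 0)
    {x : Takiff} (hx : ⁅h, x⁆ = (2 : ℂ) • x) {v : M}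
    (hv : v ∈ (act M h).maxGenEigenspace (μ hC)) : act M x v = 0 := by
  by_contra hne
  obtain ⟨k, hk⟩ := hM.weight hμ hne (act_mem_maxGenEigenspace hx hv)
  have h1 : (2 * (k + 1) : ℂ) = 0 := by linear_combination hk
  have h2 : ((k : ℂ) + 1) ≠ 0 := Nat.cast_add_one_ne_zero k
  simp [h2] at h1

/-- On the highest weight space, `h̄` has the only eigenvalue `μ(h̄)`. -/
lemma SimpleSubquotients.hBar_eq (hM : SimpleSubquotients M μ) (hμ : μ hBarC ≠ 0)
    {v : M} (hv0 : v ≠ 0) (hv : v ∈ (act M h).maxGenEigenspace (μ hC)) {c : ℂ}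
    (hc : act M hBar v = c • v) : c = μ hBarC := by
  obtain ⟨N, w, g, rfl, hg⟩ := hM.exists_hom_ne_zero hμ hv0
  have hw : act N hBar w = c • w := Subtype.ext hc
  refine eq_of_mem_maxGenEigenspace hg (A := act (verma μ) hBar) ?_
    ((hasWeight_verma μ).isBlockLike.hBar _)
  rw [← map_act, hw]
  exact (g.restrictScalars ℂ).map_smul c w

lemma SimpleSubquotients.mem_hBar (hM : SimpleSubquotients M μ) (hμ : μ hBarC ≠ 0)
    (hfin : ∀ m : M, BorelFinite m) {v : M} (hv : v ∈ (act M h).maxGenEigenspace (μ hC)) :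
    v ∈ (act M hBar).maxGenEigenspace (μ hBarC) := by
  obtain ⟨W, hvW, hW, hWs⟩ := hfin v
  let X := W ⊓ (act M h).maxGenEigenspace (μ hC)
  have : Module.Finite ℂ X := Submodule.finiteDimensional_of_le (inf_le_left : X ≤ W)
  have hX : ∀ w ∈ X, act M hBar w ∈ X := fun w hw =>
    ⟨hWs _ hBar_mem_borel _ hw.1, by
      have := act_mem_maxGenEigenspace (t := 0) (by rw [h_lie_hBar, zero_smul]) hw.2
      rwa [add_zero] at this⟩
  let B : Module.End ℂ X := (act M hBar).restrict hX
  have key := maxGenEigenspace_eq_top (A := B) (c := μ hBarC) (fun b hb => by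
    obtain ⟨u, hu⟩ := hb.exists_hasEigenvector
    exact hM.hBar_eq hμ (fun h0 => hu.2 (Subtype.ext h0)) u.2.2
      (congrArg Subtype.val (Module.End.mem_eigenspace_iff.1 hu.1))) ⟨v, hvW, hv⟩
  exact map_mem_maxGenEigenspace X.subtype _ (fun _ => rfl) key

/-- A module in the block is generated by its highest weight space. -/
lemma SimpleSubquotients.span_eq_top (hM : SimpleSubquotients M μ) (hμ : μ hBarC ≠ 0)
    (hfin : ∀ m : M, BorelFinite m) [Module.Finite U M] :
    Submodule.span U ((act M h).maxGenEigenspace (μ hC) : Set M) = ⊤ := by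
  by_contra hne
  let N := Submodule.span U ((act M h).maxGenEigenspace (μ hC) : Set M)
  have hN : N.comap (⊤ : Submodule U M).subtype ≠ ⊤ := by
    intro h0
    refine hne (eq_top_iff.2 fun m _ => ?_)
    exact h0.ge (Submodule.mem_top (x := (⟨m, Submodule.mem_top⟩ : (⊤ : Submodule U M))))
  obtain ⟨g', hg', hg0'⟩ := hM.exists_hom hμ ⊤ _ hN
  let g : M →ₗ[U] verma μ := g' ∘ₗ (Submodule.topEquiv (R := U) (M := M)).symm.toLinearMap
  have hg : Function.Surjective g := hg'.comp (LinearEquiv.surjective _)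
  have hg0 (m : M) (hm : m ∈ (act M h).maxGenEigenspace (μ hC)) : g m = 0 :=
    hg0' _ (Submodule.subset_span hm)
  obtain ⟨m, hm⟩ := hg (vermaGen μ)
  obtain ⟨W, hmW, hW, hWs⟩ := hfin m
  have hm' := mem_iSup_maxGenEigenspace (hWs h h_mem_borel) hmW
  have hle : ⨆ b : ℂ, (act M h).maxGenEigenspace b ≤
      (⨆ b : {b : ℂ // b ≠ μ hC}, (act (verma μ) h).maxGenEigenspace b).comap
        (g.restrictScalars ℂ) := by
    refine iSup_le fun b w hw => ?_
    by_cases hb : b = μ hC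
    · subst hb
      rw [Submodule.mem_comap]
      exact (hg0 w hw).symm ▸ Submodule.zero_mem _
    · exact Submodule.mem_iSup_of_mem (⟨b, hb⟩ : {b : ℂ // b ≠ μ hC})
        (map_mem_maxGenEigenspace (g.restrictScalars ℂ) b (fun v => map_act g h v) hw)
  have h1 := hle hm'
  have h2 : vermaGen μ ∈ (act (verma μ) h).maxGenEigenspace (μ hC) :=
    map_mem_maxGenEigenspace (indMk μ (ModuleCat.of ℂ ℂ)) _
      (fun v => (act_h_indMk μ (ModuleCat.of ℂ ℂ) v).symm) ((hasWeight_verma μ).h _)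
  rw [← hm] at h2
  have h3 := eq_zero_of_mem_iSup_maxGenEigenspace (fun _ => le_rfl) (fun b => b.2) h2 h1
  exact vermaGen_ne_zero μ (hm.symm.trans h3)

lemma exists_finite_stable (hfin : ∀ m : M, BorelFinite m) (s : Finset M) :
    ∃ W : Submodule ℂ M, (s : Set M) ⊆ W ∧ Module.Finite ℂ W ∧
      ∀ x ∈ borel, ∀ w ∈ W, act M x w ∈ W := by
  induction s using Finset.cons_induction with
  | empty => exact ⟨⊥, by simp, inferInstance, fun x _ w hw => by
      rw [(Submodule.mem_bot ℂ).1 hw, map_zero]; exact zero_mem _⟩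
  | cons m s _ ih =>
    obtain ⟨W, hsW, hW, hWs⟩ := ih
    obtain ⟨X, hmX, hX, hXs⟩ := hfin m
    refine ⟨W ⊔ X, ?_, inferInstance, fun x hx w hw => ?_⟩
    · rw [Finset.coe_cons]
      rintro y (rfl | hy)
      · exact Submodule.mem_sup_right hmX
      · exact Submodule.mem_sup_left (hsW hy)
    · obtain ⟨y, hy, z, hz, rfl⟩ := Submodule.mem_sup.1 hw
      rw [map_add]
      exact Submodule.add_mem_sup (hWs x hx y hy) (hXs x hx z hz)

/-- A finite-dimensional space of highest weight vectors that generates the module. -/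
lemma SimpleSubquotients.exists_generating (hM : SimpleSubquotients M μ) (hμ : μ hBarC ≠ 0)
    (hfin : ∀ m : M, BorelFinite m) [Module.Finite U M] :
    ∃ W : Submodule ℂ M, Module.Finite ℂ W ∧ W ≤ (act M h).maxGenEigenspace (μ hC) ∧
      (∀ w ∈ W, act M h w ∈ W) ∧ (∀ w ∈ W, act M hBar w ∈ W) ∧
      Submodule.span U (W : Set M) = ⊤ := by
  have htop := hM.span_eq_top hμ hfin
  obtain ⟨s, hs, hs'⟩ := (Submodule.fg_span_iff_fg_span_finset_subset _).1
    (htop.symm ▸ Module.Finite.fg_top)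
  obtain ⟨W, hsW, hW, hWs⟩ := exists_finite_stable hfin s
  refine ⟨W ⊓ (act M h).maxGenEigenspace (μ hC),
    Submodule.finiteDimensional_of_le (inf_le_left : _ ≤ W), inf_le_right,
    fun w hw => ⟨hWs _ h_mem_borel _ hw.1, ?_⟩, fun w hw => ⟨hWs _ hBar_mem_borel _ hw.1, ?_⟩, ?_⟩
  · simpa using act_mem_maxGenEigenspace (t := 0) (by rw [lie_self, zero_smul]) hw.2
  · simpa using act_mem_maxGenEigenspace (t := 0) (by rw [h_lie_hBar, zero_smul]) hw.2
  · refine eq_top_iff.2 (htop.ge.trans (hs'.le.trans (Submodule.span_mono ?_)))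
    exact fun x hx => ⟨hsW hx, hs hx⟩

/-- If an operator is diagonalizable, its generalized eigenvectors are eigenvectors. -/
lemma apply_eq_of_diagonalizable {V : Type} [AddCommGroup V] [Module ℂ V] {A : Module.End ℂ V}
    (hA : ⨆ b : ℂ, A.eigenspace b = ⊤) {a : ℂ} {v : V} (hv : v ∈ A.maxGenEigenspace a) :
    A v = a • v := by
  have hle : ⨆ b : ℂ, A.eigenspace b ≤
      A.eigenspace a ⊔ ⨆ b : {b : ℂ // b ≠ a}, A.eigenspace b := by
    refine iSup_le fun b => ?_
    by_cases hb : b = a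
    · subst hb; exact le_sup_left
    · exact le_sup_of_le_right
        (le_iSup (fun b : {b : ℂ // b ≠ a} => A.eigenspace (b : ℂ)) ⟨b, hb⟩)
  obtain ⟨y, hy, z, hz, rfl⟩ := Submodule.mem_sup.1 ((hA.ge.trans hle) (Submodule.mem_top (x := v)))
  have hza : z ∈ A.maxGenEigenspace a := by
    simpa using sub_mem hv (Module.End.eigenspace_le_maxGenEigenspace hy)
  have := eq_zero_of_mem_iSup_maxGenEigenspace
    (fun b : {b : ℂ // b ≠ a} => Module.End.eigenspace_le_maxGenEigenspace (μ := (b : ℂ)))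
    (fun b => b.2) hza hz
  rw [this, add_zero]
  exact Module.End.mem_eigenspace_iff.1 hy

end Block

/-! ### Finite-dimensional modules over power series rings -/

section PowerSeries

open MvPowerSeries

variable {σ : Type} [Finite σ]

section Action

variable {V W : Type} [AddCommGroup V] [Module (MvPowerSeries σ ℂ) V] [Module ℂ V]
  [IsScalarTower ℂ (MvPowerSeries σ ℂ) V] [Module.Finite ℂ V]
  [AddCommGroup W] [Module (MvPowerSeries σ ℂ) W] [Module ℂ W]
  [IsScalarTower ℂ (MvPowerSeries σ ℂ) W] [Module.Finite ℂ W]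

omit [Finite σ] in
/-- A variable acts nilpotently on a finite-dimensional module: it has no eigenvalue `b ≠ 0`, since
`X i - b` is invertible. -/
lemma X_mem_radical_torsionOf (i : σ) (v : V) :
    (X i : MvPowerSeries σ ℂ) ∈ (Ideal.torsionOf (MvPowerSeries σ ℂ) V v).radical := by
  have h0 := maxGenEigenspace_eq_top (A := Algebra.lsmul ℂ ℂ V (X i : MvPowerSeries σ ℂ)) (c := 0)
    (fun b hb => by
      by_contra hne
      obtain ⟨w, hw⟩ := hb.exists_hasEigenvector
      have hu : IsUnit ((X i : MvPowerSeries σ ℂ) - algebraMap ℂ _ b) := by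
        rw [MvPowerSeries.isUnit_iff_constantCoeff]
        simp [MvPowerSeries.algebraMap_apply, hne]
      refine hw.2 ((hu.smul_eq_zero).1 ?_)
      rw [sub_smul, algebraMap_smul, sub_eq_zero]
      exact Module.End.mem_eigenspace_iff.1 hw.1) v
  simpa using (mem_maxGenEigenspace_lsmul _ _ _).1 h0

/-- A power series without terms of multidegree at most `(N, …, N)` lies in the ideal generated by
the `N`-th powers of the variables. -/
lemma mem_span_X_pow (N : ℕ) (r : MvPowerSeries σ ℂ)
    (hr : ∀ m : σ →₀ ℕ, (∀ i, m i ≤ N) → coeff m r = 0) :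
    r ∈ Ideal.span (Set.range fun i : σ => (X i : MvPowerSeries σ ℂ) ^ N) := by
  classical
  have := Fintype.ofFinite σ
  -- Each monomial that occurs is assigned to a variable with exponent greater than `N`.
  have hex (m : σ →₀ ℕ) : ∃ i : Option σ, (¬ ∀ j, m j ≤ N) → ∃ j, i = some j ∧ ¬ m j ≤ N := by
    by_cases hm : ∀ j, m j ≤ N
    · exact ⟨none, fun h0 => absurd hm h0⟩
    · obtain ⟨j, hj⟩ := not_forall.1 hm
      exact ⟨some j, fun _ => ⟨j, rfl, hj⟩⟩
  choose pick hpick using hex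
  let s (i : σ) : MvPowerSeries σ ℂ := fun m =>
    if (¬ ∀ j, m j ≤ N) ∧ pick m = some i then coeff m r else 0
  have hs (i : σ) (m : σ →₀ ℕ) :
      coeff m (s i) = if (¬ ∀ j, m j ≤ N) ∧ pick m = some i then coeff m r else 0 := rfl
  have hsum : r = ∑ i, s i := by
    ext m
    rw [map_sum]
    simp only [hs]
    by_cases hm : ∀ j, m j ≤ N
    · simp [hm, hr m hm]
    · obtain ⟨j, hj, -⟩ := hpick m hm
      simp [hm, hj]
  rw [hsum]
  refine Ideal.sum_mem _ fun i _ => ?_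
  have hd : (X i : MvPowerSeries σ ℂ) ^ N ∣ s i := by
    rw [MvPowerSeries.X_pow_dvd_iff]
    intro m hm
    rw [hs, if_neg]
    rintro ⟨h1, h2⟩
    obtain ⟨j, hj, hjm⟩ := hpick m h1
    obtain rfl : j = i := Option.some.inj (hj.symm.trans h2)
    exact hjm hm.le
  exact Ideal.mem_of_dvd _ hd (Ideal.subset_span ⟨i, rfl⟩)

lemma exists_X_pow_smul (v : V) :
    ∃ N, ∀ n ≥ N, ∀ i, (X i : MvPowerSeries σ ℂ) ^ n • v = 0 := by
  have := Fintype.ofFinite σ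
  choose k hk using fun i => X_mem_radical_torsionOf (σ := σ) i v
  refine ⟨Finset.univ.sup k, fun n hn i => ?_⟩
  exact Ideal.pow_mem_of_pow_mem _ (hk i) ((Finset.le_sup (Finset.mem_univ i)).trans hn)

/-- A linear map between finite-dimensional modules that commutes with the variables is linear over
power series. -/
lemma map_powerSeries_smul (g : V →ₗ[ℂ] W)
    (hg : ∀ i v, g ((X i : MvPowerSeries σ ℂ) • v) = (X i : MvPowerSeries σ ℂ) • g v)
    (r : MvPowerSeries σ ℂ) (v : V) : g (r • v) = r • g v := by
  classical
  have := Fintype.ofFinite σ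
  have hpoly (p : MvPolynomial σ ℂ) (v : V) :
      g ((p : MvPowerSeries σ ℂ) • v) = (p : MvPowerSeries σ ℂ) • g v := by
    induction p using MvPolynomial.induction_on generalizing v with
    | C t =>
      rw [MvPolynomial.coe_C]
      change g (algebraMap ℂ (MvPowerSeries σ ℂ) t • v) = algebraMap ℂ (MvPowerSeries σ ℂ) t • g v
      rw [algebraMap_smul, algebraMap_smul, map_smul]
    | add p q hp hq =>
      rw [MvPolynomial.coe_add, add_smul, add_smul, map_add, hp, hq]
    | mul_X p i hp =>
      rw [MvPolynomial.coe_mul, MvPolynomial.coe_X, mul_smul, hp, hg, mul_smul]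
  obtain ⟨N1, h1⟩ := exists_X_pow_smul (σ := σ) v
  obtain ⟨N2, h2⟩ := exists_X_pow_smul (σ := σ) (g v)
  let N := max N1 N2
  let n : σ →₀ ℕ := Finsupp.equivFunOnFinite.symm fun _ => N
  let p := trunc' ℂ n r
  have hmem := mem_span_X_pow N (r - (p : MvPowerSeries σ ℂ)) (fun m hm => by
    have : m ≤ n := hm
    rw [map_sub, MvPolynomial.coeff_coe, coeff_trunc', if_pos this, sub_self])
  have kill {Z : Type} [AddCommGroup Z] [Module (MvPowerSeries σ ℂ) Z] (z : Z)
      (hz : ∀ i, (X i : MvPowerSeries σ ℂ) ^ N • z = 0) : r • z = (p : MvPowerSeries σ ℂ) • z := by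
    rw [← sub_eq_zero, ← sub_smul]
    have hle : Ideal.span (Set.range fun i : σ => (X i : MvPowerSeries σ ℂ) ^ N) ≤
        Ideal.torsionOf (MvPowerSeries σ ℂ) Z z := by
      refine Ideal.span_le.2 ?_
      rintro _ ⟨i, rfl⟩
      exact hz i
    exact hle hmem
  rw [kill v (h1 N (le_max_left _ _)), kill (g v) (h2 N (le_max_right _ _)), hpoly]

end Action

/-- Nilpotent elements of a commutative algebra define a homomorphism from the power series
ring. -/
lemma exists_powerSeries_hom {A : Type} [CommRing A] [Algebra ℂ A] (a : σ → A)
    (ha : ∀ i, IsNilpotent (a i)) :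
    ∃ θ : MvPowerSeries σ ℂ →ₐ[ℂ] A, ∀ i, θ (X i) = a i := by
  classical
  have := Fintype.ofFinite σ
  choose k hk using ha
  let N := Finset.univ.sup k + 1
  have hN (i : σ) {n : ℕ} (hn : N ≤ n) : a i ^ n = 0 :=
    pow_eq_zero_of_le (((Finset.le_sup (Finset.mem_univ i)).trans (Nat.le_succ _)).trans hn) (hk i)
  let n : σ →₀ ℕ := Finsupp.equivFunOnFinite.symm fun _ => N
  -- Truncation at `n` is multiplicative up to terms that vanish at `a`.
  have kill (p : MvPolynomial σ ℂ) (hp : ∀ m ≤ n, p.coeff m = 0) : MvPolynomial.aeval a p = 0 := by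
    rw [MvPolynomial.aeval_def, MvPolynomial.eval₂_eq']
    refine Finset.sum_eq_zero fun m hm => ?_
    have hmn : ¬ ∀ i, m i ≤ n i := fun hmn => (MvPolynomial.mem_support_iff.1 hm) (hp m hmn)
    obtain ⟨i, hi⟩ := not_forall.1 hmn
    have hi' : N ≤ m i := (not_le.1 hi).le
    rw [Finset.prod_eq_zero (Finset.mem_univ i) (hN i hi'), mul_zero]
  have hmul (r s : MvPowerSeries σ ℂ) : MvPolynomial.aeval a (trunc' ℂ n (r * s)) =
      MvPolynomial.aeval a (trunc' ℂ n r) * MvPolynomial.aeval a (trunc' ℂ n s) := by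
    rw [← map_mul, ← sub_eq_zero, ← map_sub]
    refine kill _ fun m hm => ?_
    rw [MvPolynomial.coeff_sub, coeff_trunc', if_pos hm,
      ← coeff_trunc'_mul_trunc'_eq_coeff_mul n r s hm, sub_self]
  let θ : MvPowerSeries σ ℂ →ₐ[ℂ] A :=
    { toFun := fun r => MvPolynomial.aeval a (trunc' ℂ n r)
      map_one' := by rw [trunc'_one, map_one]
      map_mul' := hmul
      map_zero' := by rw [map_zero, map_zero]
      map_add' := fun r s => by rw [map_add, map_add]
      commutes' := fun t => by
        change MvPolynomial.aeval a (trunc' ℂ n (C t)) = _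
        rw [trunc'_C, MvPolynomial.aeval_C] }
  refine ⟨θ, fun i => ?_⟩
  have hX : trunc' ℂ n (X i : MvPowerSeries σ ℂ) = MvPolynomial.X i := by
    ext m
    rw [coeff_trunc', MvPolynomial.coeff_X, coeff_X]
    by_cases hm : m = Finsupp.single i 1
    · have hn : n i ≠ 0 := Nat.succ_ne_zero _
      simp [hm, hn]
    · simp [hm, Ne.symm hm]
  change MvPolynomial.aeval a (trunc' ℂ n (X i)) = a i
  rw [hX, MvPolynomial.aeval_X]

/-- Commuting nilpotent operators define a module over the power series ring. -/
lemma exists_powerSeries_action {V : Type} [AddCommGroup V] [Module ℂ V]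
    (a : σ → Module.End ℂ V) (ha : ∀ i, IsNilpotent (a i)) (hc : ∀ i j, a i * a j = a j * a i) :
    ∃ θ : MvPowerSeries σ ℂ →ₐ[ℂ] Module.End ℂ V, ∀ i, θ (X i) = a i := by
  let S := Algebra.adjoin ℂ (Set.range a)
  have : IsMulCommutative S := Algebra.isMulCommutative_adjoin ℂ (by
    rintro _ ⟨i, rfl⟩ _ ⟨j, rfl⟩
    exact hc i j)
  let _ : CommRing S := { (inferInstance : Ring S) with mul_comm := mul_comm' }
  let b (i : σ) : S := ⟨a i, Algebra.subset_adjoin ⟨i, rfl⟩⟩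
  obtain ⟨θ, hθ⟩ := exists_powerSeries_hom b (fun i => by
    obtain ⟨k, hk⟩ := ha i
    exact ⟨k, Subtype.ext hk⟩)
  exact ⟨S.val.comp θ, fun i => congrArg Subtype.val (hθ i)⟩

end PowerSeries

/-! ### Highest weight spaces of induced modules -/

section WeightSpace

variable {R : Type} [CommRing R] [Algebra ℂ R]

lemma shiftedWeight_hC (μ : Weight) (x y : R) :
    shiftedWeight μ x y hC = algebraMap ℂ R (μ hC) + y := by
  have h1 : coordH h = 1 := by simp [coordH, h, coord_tens, sl2Coord_sl2h]
  have h2 : coordHBar h = 0 := by simp [coordHBar, h, coord_tens]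
  change algebraMap ℂ R (μ hC) + (coordHBar h • x + coordH h • y) = _
  rw [h1, h2, zero_smul, one_smul, zero_add]

lemma shiftedWeight_hBarC (μ : Weight) (x y : R) :
    shiftedWeight μ x y hBarC = algebraMap ℂ R (μ hBarC) + x := by
  have h1 : coordH hBar = 0 := by simp [coordH, hBar, coord_tens]
  have h2 : coordHBar hBar = 1 := by simp [coordHBar, hBar, coord_tens, sl2Coord_sl2h]
  change algebraMap ℂ R (μ hBarC) + (coordHBar hBar • x + coordH hBar • y) = _
  rw [h1, h2, zero_smul, one_smul, add_zero]

lemma inclH_smul_indMk (φ : cartan →ₗ[ℂ] R) (V : ModuleCat.{0} R) (u : UH) (v : V) :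
    inclH u • indMk φ V v = indMk φ V (cartanHom φ u • v) := by
  revert v
  refine envelope_induction
    (p := fun u : UH => ∀ v, inclH u • indMk φ V v = indMk φ V (cartanHom φ u • v))
    { carrier := {u : UH | ∀ v, inclH u • indMk φ V v = indMk φ V (cartanHom φ u • v)}
      mul_mem' := fun {a b} ha hb m => by
        rw [map_mul, mul_smul, hb, ha, map_mul, mul_smul]
      one_mem' := fun m => by rw [map_one, one_smul, map_one, one_smul]
      add_mem' := fun {a b} ha hb m => by
        rw [map_add, add_smul, ha, hb, map_add, add_smul, map_add]
      zero_mem' := fun m => by rw [map_zero, map_zero, zero_smul, zero_smul, map_zero]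
      algebraMap_mem' := fun r m => by
        rw [AlgHom.commutes, AlgHom.commutes, algebraMap_smul, algebraMap_smul, map_smul] }
    (fun z v => ?_) (fun u hu => hu) u
  rw [inclH_ι, cartanHom_ι]
  have := act_indMk_of_mem_borel φ V (cartan_le_borel z.2) v
  rw [proj_of_mem] at this
  exact this

/-- Modulo `(x, y)`, the shifted weight is the weight itself. -/
lemma cartanHom_sub_mem (μ : Weight) (x y : R) (u : UH) :
    cartanHom (shiftedWeight μ x y) u - algebraMap ℂ R (cartanHom μ u) ∈ Ideal.span {x, y} := by
  have hx : x ∈ Ideal.span {x, y} := Ideal.subset_span (by simp)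
  have hy : y ∈ Ideal.span {x, y} := Ideal.subset_span (by simp)
  have key : (Ideal.Quotient.mkₐ ℂ (Ideal.span {x, y})).comp (cartanHom (shiftedWeight μ x y)) =
      ((Ideal.Quotient.mkₐ ℂ (Ideal.span {x, y})).comp (Algebra.ofId ℂ R)).comp
        (cartanHom μ) := by
    refine UniversalEnvelopingAlgebra.hom_ext ℂ (LieHom.ext fun z => ?_)
    change Ideal.Quotient.mkₐ ℂ (Ideal.span {x, y})
        (cartanHom (shiftedWeight μ x y) (UniversalEnvelopingAlgebra.ι ℂ z)) =
      Ideal.Quotient.mkₐ ℂ (Ideal.span {x, y})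
        (algebraMap ℂ R (cartanHom μ (UniversalEnvelopingAlgebra.ι ℂ z)))
    rw [cartanHom_ι, cartanHom_ι]
    refine Ideal.Quotient.eq.2 ?_
    change (algebraMap ℂ R (μ z) + (coordHBar z • x + coordH z • y)) - _ ∈ _
    rw [add_sub_cancel_left]
    refine add_mem ?_ ?_ <;> rw [Algebra.smul_def]
    · exact Ideal.mul_mem_left _ _ hx
    · exact Ideal.mul_mem_left _ _ hy
  exact Ideal.Quotient.eq.1 (congrArg (fun k => k u) key)

lemma maxIdeal_pow_le (μ : Weight) (x y : R) (k : ℕ) (u : UH) (hu : u ∈ maxIdeal μ ^ k) :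
    cartanHom (shiftedWeight μ x y) u ∈ Ideal.span {x, y} ^ k := by
  have hle : maxIdeal μ ^ k ≤
      (Ideal.span {x, y} ^ k).comap (cartanHom (shiftedWeight μ x y)) := by
    clear hu
    induction k with
    | zero => intro u _; simp
    | succ k ih =>
      rw [Submodule.pow_succ, Ideal.mul_le]
      intro r hr s hs
      rw [Ideal.mem_comap, map_mul, pow_succ]
      refine Ideal.mul_mem_mul (ih hr) ?_
      have := cartanHom_sub_mem μ x y s
      rwa [(RingHom.mem_ker.1 hs : cartanHom μ s = 0), map_zero, sub_zero] at this
  exact hle hu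

lemma mem_maxGenEigenspace_of_mem_genWeightSpace (μ : Weight) (M : ModuleCat.{0} U) (m : M)
    (hm : m ∈ genWeightSpace μ ((ModuleCat.restrictScalars inclH.toRingHom).obj M)) :
    m ∈ (act M h).maxGenEigenspace (μ hC) := by
  obtain ⟨k, hk⟩ := hm
  rw [Module.End.mem_maxGenEigenspace]
  refine ⟨k, ?_⟩
  let u : UH := UniversalEnvelopingAlgebra.ι ℂ hC - algebraMap ℂ UH (μ hC)
  have hu : u ∈ maxIdeal μ := by
    change cartanHom μ u = 0
    rw [map_sub, cartanHom_ι, AlgHom.commutes]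
    exact sub_self _
  have h1 : inclH (u ^ k) • m = 0 := hk _ (Ideal.pow_mem_pow hu k)
  have h2 : Algebra.lsmul ℂ ℂ M (inclH u) = act M h - μ hC • 1 := by
    refine LinearMap.ext fun w => ?_
    change inclH u • w = act M h w - μ hC • w
    rw [map_sub, inclH_ι, AlgHom.commutes, sub_smul, algebraMap_smul]
    rfl
  rw [← h2, ← map_pow, ← map_pow]
  exact h1

/-- The image of `1 ⊗ V` in the induced module is the generalized weight space. -/
lemma exists_weightSpace_equiv (μ : Weight) (x y : R) (V : ModuleCat.{0} R)
    (hV : HasWeight (shiftedWeight μ x y) V (μ hC) (μ hBarC))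
    (hx : ∀ v : V, x ∈ (Ideal.torsionOf R V v).radical)
    (hy : ∀ v : V, y ∈ (Ideal.torsionOf R V v).radical) :
    ∃ E : (ModuleCat.restrictScalars (cartanHom (shiftedWeight μ x y)).toRingHom).obj V ≃ₗ[UH]
      (weightFunctor μ).obj ((parabolicInd (shiftedWeight μ x y)).obj V),
      ∀ v, ((E v).1 : (parabolicInd (shiftedWeight μ x y)).obj V) =
        indMk (shiftedWeight μ x y) V v := by
  have hmem (v : V) : indMk (shiftedWeight μ x y) V v ∈ genWeightSpace μ
      ((ModuleCat.restrictScalars inclH.toRingHom).obj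
        ((parabolicInd (shiftedWeight μ x y)).obj V)) := by
    have hle : Ideal.span {x, y} ≤ (Ideal.torsionOf R V v).radical := by
      refine Ideal.span_le.2 ?_
      rintro _ (rfl | rfl)
      · exact hx v
      · exact hy v
    obtain ⟨k, hk⟩ := Ideal.exists_pow_le_of_le_radical_of_fg hle
      (Submodule.fg_span (by simp))
    refine ⟨k, fun u hu => (inclH_smul_indMk _ V u v).trans ?_⟩
    have : cartanHom (shiftedWeight μ x y) u • v = 0 := hk (maxIdeal_pow_le μ x y k u hu)
    rw [this, map_zero]
    rfl
  let E : (ModuleCat.restrictScalars (cartanHom (shiftedWeight μ x y)).toRingHom).obj V →ₗ[UH]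
      (weightFunctor μ).obj ((parabolicInd (shiftedWeight μ x y)).obj V) :=
    { toFun := fun v => ⟨indMk (shiftedWeight μ x y) V v, hmem v⟩
      map_add' := fun v w => Subtype.ext (map_add (indMk (shiftedWeight μ x y) V) v w)
      map_smul' := fun u v => Subtype.ext (inclH_smul_indMk (shiftedWeight μ x y) V u v).symm }
  refine ⟨LinearEquiv.ofBijective E ⟨fun v w hvw => ?_, ?_⟩, fun v => rfl⟩
  · exact indMk_injective _ V (congrArg Subtype.val hvw)
  · rintro ⟨w, hw⟩
    obtain ⟨v, hv⟩ := mem_range_indMk hV.h (mem_maxGenEigenspace_of_mem_genWeightSpace μ _ w hw)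
    exact ⟨v, Subtype.ext hv⟩

end WeightSpace

/-! ### Locally finite modules over the Borel subalgebra -/

section LocallyFinite

lemma inclB_smul_mem {M : ModuleCat.{0} U} {W : Submodule ℂ M}
    (hW : ∀ x ∈ borel, ∀ w ∈ W, act M x w ∈ W) (u : UB) (w : M) (hw : w ∈ W) :
    inclB u • w ∈ W := by
  revert w
  refine envelope_induction (p := fun u : UB => ∀ w ∈ W, inclB u • w ∈ W)
    { carrier := {u : UB | ∀ w ∈ W, inclB u • w ∈ W}
      mul_mem' := fun {a b} ha hb m hm => by rw [map_mul, mul_smul]; exact ha _ (hb _ hm)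
      one_mem' := fun m hm => by rwa [map_one, one_smul]
      add_mem' := fun {a b} ha hb m hm => by
        rw [map_add, add_smul]; exact add_mem (ha _ hm) (hb _ hm)
      zero_mem' := fun m hm => by rw [map_zero, zero_smul]; exact zero_mem _
      algebraMap_mem' := fun r m hm => by
        rw [AlgHom.commutes, algebraMap_smul]; exact W.smul_mem r hm }
    (fun z v hv => ?_) (fun u hu => hu) u
  rw [inclB_ι]
  exact hW z z.2 v hv

lemma locallyFinite_iff (M : ModuleCat.{0} U) :
    LocallyFinite ((ModuleCat.restrictScalars inclB.toRingHom).obj M) ↔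
      ∀ m : M, BorelFinite m := by
  refine forall_congr' fun m => ?_
  let N : Submodule UB ((ModuleCat.restrictScalars inclB.toRingHom).obj M) :=
    Submodule.span UB {m}
  let val (n : N) : M := n.1
  let k : ModuleCat.of UB N →ₗ[ℂ] M :=
    { toFun := val
      map_add' := fun _ _ => rfl
      map_smul' := fun t n => by
        change inclB (algebraMap ℂ UB t) • val n = t • val n
        rw [AlgHom.commutes, algebraMap_smul] }
  constructor
  · intro hm
    have : Module.Finite ℂ (ModuleCat.of UB N) := hm
    refine ⟨LinearMap.range k, ⟨⟨m, Submodule.mem_span_singleton_self m⟩, rfl⟩, inferInstance, ?_⟩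
    rintro x hx _ ⟨n, rfl⟩
    refine ⟨(UniversalEnvelopingAlgebra.ι ℂ (⟨x, hx⟩ : borel) : UB) • n, ?_⟩
    change inclB (UniversalEnvelopingAlgebra.ι ℂ (⟨x, hx⟩ : borel)) • val n = _
    rw [inclB_ι]
    rfl
  · rintro ⟨W, hmW, hW, hWs⟩
    have hk (n) : k n ∈ W := by
      obtain ⟨n, hn⟩ := n
      obtain ⟨u, rfl⟩ := Submodule.mem_span_singleton.1 hn
      exact inclB_smul_mem hWs u m hmW
    exact Module.Finite.of_injective (k.codRestrict W hk)
      (fun a b hab => Subtype.ext (congrArg (fun z : W => (z : M)) hab))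

end LocallyFinite

/-! ### The equivalence of categories -/

section Equivalence

variable {R : Type} [CommRing R] [Algebra ℂ R]

/-- The properties of `R = ℂ⟦x, y⟧`, or of `R = ℂ⟦x⟧` with `y = 0`, on which the equivalence
depends: finite-dimensional `R`-modules are the same as finite-dimensional vector spaces with
commuting nilpotent operators `x` and `y`, where the second operator is zero if `y = 0`. -/
structure IsSeriesRing (x y : R) : Prop where
  nilpotent_x (V : ModuleCat.{0} R) (hV : Module.Finite ℂ V) (v : V) :
    x ∈ (Ideal.torsionOf R V v).radical
  nilpotent_y (V : ModuleCat.{0} R) (hV : Module.Finite ℂ V) (v : V) :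
    y ∈ (Ideal.torsionOf R V v).radical
  linear (V W : ModuleCat.{0} R) (hV : Module.Finite ℂ V) (hW : Module.Finite ℂ W)
    (g : V →ₗ[ℂ] W) (hx : ∀ v, g (x • v) = x • g v) (hy : ∀ v, g (y • v) = y • g v)
    (r : R) (v : V) : g (r • v) = r • g v
  exists_action {V : Type} [AddCommGroup V] [Module ℂ V] (A B : Module.End ℂ V)
    (hA : IsNilpotent A) (hB : IsNilpotent B) (hAB : A * B = B * A) (hy : y = 0 → B = 0) :
    ∃ θ : R →ₐ[ℂ] Module.End ℂ V, θ x = A ∧ θ y = B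

lemma isSeriesRing_powerSeries :
    IsSeriesRing (PowerSeries.X : PowerSeries ℂ) (0 : PowerSeries ℂ) where
  nilpotent_x V hV v := X_mem_radical_torsionOf (σ := Unit) () v
  nilpotent_y V hV v := Submodule.zero_mem _
  linear V W hV hW g hx _ r v := map_powerSeries_smul (σ := Unit) g (fun _ => hx) r v
  exists_action A B hA _ _ hy := by
    obtain ⟨θ, hθ⟩ := exists_powerSeries_action (fun _ : Unit => A) (fun _ => hA)
      (fun _ _ => rfl)
    exact ⟨θ, hθ (), (map_zero θ).trans (hy rfl).symm⟩

lemma isSeriesRing_mvPowerSeries :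
    IsSeriesRing (MvPowerSeries.X 0 : MvPowerSeries (Fin 2) ℂ) (MvPowerSeries.X 1) where
  nilpotent_x V hV v := X_mem_radical_torsionOf 0 v
  nilpotent_y V hV v := X_mem_radical_torsionOf 1 v
  linear V W hV hW g hx hy r v := map_powerSeries_smul g (Fin.forall_fin_two.2 ⟨hx, hy⟩) r v
  exists_action A B hA hB hAB _ := by
    obtain ⟨θ, hθ⟩ := exists_powerSeries_action ![A, B] (Fin.forall_fin_two.2 ⟨hA, hB⟩)
      (Fin.forall_fin_two.2 ⟨Fin.forall_fin_two.2 ⟨rfl, hAB⟩, Fin.forall_fin_two.2 ⟨hAB.symm, rfl⟩⟩)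
    exact ⟨θ, hθ 0, hθ 1⟩

section Representation

variable {W : Type} [AddCommGroup W] [Module ℂ W]

/-- The space of a representation of `R`. It is a copy of `W`, so that its vector space structure
is the one that comes from `R`. -/
def RepSpace (_ : R →ₐ[ℂ] Module.End ℂ W) : Type := W

instance (θ : R →ₐ[ℂ] Module.End ℂ W) : AddCommGroup (RepSpace θ) :=
  inferInstanceAs (AddCommGroup W)

instance (θ : R →ₐ[ℂ] Module.End ℂ W) : Module R (RepSpace θ) := Module.compHom W θ.toRingHom

/-- A representation of `R`, as an `R`-module. -/
def repModule (θ : R →ₐ[ℂ] Module.End ℂ W) : ModuleCat.{0} R := ModuleCat.of R (RepSpace θ)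

lemma exists_moduleCat (θ : R →ₐ[ℂ] Module.End ℂ W) :
    ∃ (V : ModuleCat.{0} R) (i : W ≃ₗ[ℂ] V), ∀ r w, i (θ r w) = r • i w := by
  let i : W ≃+ repModule θ := AddEquiv.refl W
  have hi (t : ℂ) (w : W) : i (t • w) = t • i w :=
    (congrArg (fun k : Module.End ℂ W => k w) (θ.commutes t)).symm
  exact ⟨repModule θ, i.toLinearEquiv hi, fun _ _ => rfl⟩

end Representation

lemma isNilpotent_sub_of_maxGenEigenspace {W : Type} [AddCommGroup W] [Module ℂ W]
    [Module.Finite ℂ W] {C : Module.End ℂ W} {t : ℂ} (hC : ∀ w, w ∈ C.maxGenEigenspace t) :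
    IsNilpotent (C - t • 1) := by
  refine ⟨Module.finrank ℂ W, LinearMap.ext fun w => ?_⟩
  have := hC w
  rw [Module.End.maxGenEigenspace_eq_genEigenspace_finrank, Module.End.mem_genEigenspace_nat] at this
  exact this

variable {x y : R} (hR : IsSeriesRing x y) (μ : Weight)

include hR

lemma IsSeriesRing.hasWeight (V : ModuleCat.{0} R) (hV : Module.Finite ℂ V) :
    HasWeight (shiftedWeight μ x y) V (μ hC) (μ hBarC) where
  finite := hV
  h v := by
    rw [mem_maxGenEigenspace_lsmul, shiftedWeight_hC, add_sub_cancel_left]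
    exact hR.nilpotent_y V hV v
  hBar v := by
    rw [mem_maxGenEigenspace_lsmul, shiftedWeight_hBarC, add_sub_cancel_left]
    exact hR.nilpotent_x V hV v

/-- Induced modules lie in the block. -/
lemma IsSeriesRing.block_ind {X : ObjectProperty (ModuleCat.{0} U)}
    (hX : ∀ M : ModuleCat.{0} U, X M ↔
      thickO M ∧ (y = 0 → ⨆ b : ℂ, (act M h).eigenspace b = ⊤))
    {μ : Weight} (hμ : μ hBarC ≠ 0) (V : ModuleCat.{0} R) (hV : Module.Finite ℂ V) :
    block X μ ((parabolicInd (shiftedWeight μ x y)).obj V) := by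
  have hw := hR.hasWeight μ V hV
  refine ⟨(hX _).2 ⟨⟨hw.finite_ind, (locallyFinite_iff _).2 hw.isBlockLike.fin⟩, fun hy => ?_⟩,
    fun N P hNP => ?_⟩
  · refine iSup_eigenspace_ind (a := μ hC) fun v => ?_
    rw [shiftedWeight_hC, hy, add_zero, algebraMap_smul]
  · exact nonempty_equiv_simpleL hμ ((hw.isBlockLike.of_injective N.subtype
      Subtype.val_injective).of_surjective P.mkQ P.mkQ_surjective)

/-- Every module in the block is induced from a finite-dimensional module. -/
lemma IsSeriesRing.exists_ind_equiv {X : ObjectProperty (ModuleCat.{0} U)}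
    (hX : ∀ M : ModuleCat.{0} U, X M ↔
      thickO M ∧ (y = 0 → ⨆ b : ℂ, (act M h).eigenspace b = ⊤))
    {μ : Weight} (hμ : μ hBarC ≠ 0) (M : ModuleCat.{0} U) (hM : block X μ M) :
    ∃ V : ModuleCat.{0} R, Module.Finite ℂ V ∧
      Nonempty ((parabolicInd (shiftedWeight μ x y)).obj V ≃ₗ[U] M) := by
  obtain ⟨hXM, hs⟩ := hM
  obtain ⟨⟨hfg, hlf⟩, hd⟩ := (hX M).1 hXM
  have hfin := (locallyFinite_iff M).1 hlf
  have hss : SimpleSubquotients M μ := hs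
  obtain ⟨W, hW, hWle, hWh, hWhb, htop⟩ := hss.exists_generating hμ hfin
  let H : Module.End ℂ W := (act M h).restrict hWh
  let H' : Module.End ℂ W := (act M hBar).restrict hWhb
  have hHmem (w : W) : w ∈ H.maxGenEigenspace (μ hC) :=
    mem_maxGenEigenspace_of_map W.subtype _ (fun _ => rfl) Subtype.val_injective (hWle w.2)
  have hHmem' (w : W) : w ∈ H'.maxGenEigenspace (μ hBarC) :=
    mem_maxGenEigenspace_of_map W.subtype _ (fun _ => rfl) Subtype.val_injective
      (hss.mem_hBar hμ hfin (hWle w.2))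
  have hcomm : (H' - μ hBarC • 1) * (H - μ hC • 1) = (H - μ hC • 1) * (H' - μ hBarC • 1) := by
    have hc : Commute H' H := LinearMap.ext fun w => Subtype.ext (act_hBar_h (w : M))
    exact ((hc.sub_right ((Commute.one_right _).smul_right _)).sub_left
      ((Commute.one_left _).smul_left _)).eq
  obtain ⟨θ, hθx, hθy⟩ := hR.exists_action _ _ (isNilpotent_sub_of_maxGenEigenspace hHmem')
    (isNilpotent_sub_of_maxGenEigenspace hHmem) hcomm (fun hy => by
    refine sub_eq_zero.2 (LinearMap.ext fun w => Subtype.ext ?_)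
    exact apply_eq_of_diagonalizable (hd hy) (hWle w.2))
  obtain ⟨V, i, hi⟩ := exists_moduleCat θ
  have hV : Module.Finite ℂ V := Module.Finite.equiv i
  let g : V →ₗ[ℂ] M := W.subtype ∘ₗ i.symm.toLinearMap
  have hg (w : W) : g (i w) = w := congrArg Subtype.val (i.symm_apply_apply w)
  have hgr (r : R) (v : V) : g (r • v) = θ r (i.symm v) := by
    rw [← hg, hi, i.apply_symm_apply]
  refine ⟨V, hV, ?_⟩
  let G := indLift (shiftedWeight μ x y) V g
    (fun v => hss.act_eq_zero hμ h_lie_e (hWle (i.symm v).2))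
    (fun v => hss.act_eq_zero hμ h_lie_eBar (hWle (i.symm v).2))
    (fun v => by
      rw [shiftedWeight_hC, add_smul, map_add, algebraMap_smul, map_smul, hgr, hθy]
      exact (add_sub_cancel (μ hC • g v) (act M h (g v))).symm)
    (fun v => by
      rw [shiftedWeight_hBarC, add_smul, map_add, algebraMap_smul, map_smul, hgr, hθx]
      exact (add_sub_cancel (μ hBarC • g v) (act M hBar (g v))).symm)
  have hG (v : V) : G (indMk (shiftedWeight μ x y) V v) = g v := indLift_indMk _ _ _ _ _ _ _ v
  refine ⟨LinearEquiv.ofBijective G ⟨?_, ?_⟩⟩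
  · refine (hR.hasWeight μ V hV).injective_of_injective hμ G fun v hv => ?_
    rw [hG] at hv
    exact i.symm.map_eq_zero_iff.1 (Subtype.ext hv)
  · rw [← LinearMap.range_eq_top]
    refine eq_top_iff.2 (htop.ge.trans (Submodule.span_le.2 fun w hw => ?_))
    exact ⟨indMk _ V (i ⟨w, hw⟩), (hG _).trans (hg _)⟩

/-- Intertwiners between induced modules are induced. -/
lemma IsSeriesRing.exists_map_eq (V W : ModuleCat.{0} R) (hV : Module.Finite ℂ V)
    (hW : Module.Finite ℂ W) (g : (parabolicInd (shiftedWeight μ x y)).obj V ⟶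
      (parabolicInd (shiftedWeight μ x y)).obj W) :
    ∃ k : V ⟶ W, (parabolicInd (shiftedWeight μ x y)).map k = g := by
  let φ := shiftedWeight μ x y
  have hwV := hR.hasWeight μ V hV
  have hwW := hR.hasWeight μ W hW
  have hmem (v : V) : g.hom (indMk φ V v) ∈ LinearMap.range (indMk φ W) := by
    refine mem_range_indMk hwW.h ?_
    refine map_mem_maxGenEigenspace (A := act _ h) (g.hom.restrictScalars ℂ) _
      (fun v => map_act g.hom h v) ?_
    exact map_mem_maxGenEigenspace (indMk φ V) _ (fun v => (act_h_indMk φ V v).symm) (hwV.h v)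
  let k : V →ₗ[ℂ] W := (LinearEquiv.ofInjective _ (indMk_injective φ W)).symm.toLinearMap ∘ₗ
    ((g.hom.restrictScalars ℂ) ∘ₗ indMk φ V).codRestrict _ hmem
  have hk (v : V) : indMk φ W (k v) = g.hom (indMk φ V v) :=
    congrArg Subtype.val (LinearEquiv.apply_symm_apply
      (LinearEquiv.ofInjective _ (indMk_injective φ W)) _)
  have hφ (z : Takiff) (r : R) (t : ℂ)
      (h1 : ∀ v, act _ z (indMk φ V v) = indMk φ V ((algebraMap ℂ R t + r) • v))
      (h2 : ∀ v, act _ z (indMk φ W v) = indMk φ W ((algebraMap ℂ R t + r) • v))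
      (v : V) : k (r • v) = r • k v := by
    have : k ((algebraMap ℂ R t + r) • v) = (algebraMap ℂ R t + r) • k v := by
      refine indMk_injective φ W ?_
      rw [hk, ← h1, ← h2, hk]
      exact map_act g.hom z _
    rw [add_smul, add_smul, map_add, algebraMap_smul, algebraMap_smul, map_smul] at this
    exact add_left_cancel this
  have hlin := hR.linear V W hV hW k
    (hφ hBar x (μ hBarC) (fun v => by rw [act_hBar_indMk, shiftedWeight_hBarC])
      (fun v => by rw [act_hBar_indMk, shiftedWeight_hBarC]))
    (hφ h y (μ hC) (fun v => by rw [act_h_indMk, shiftedWeight_hC])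
      (fun v => by rw [act_h_indMk, shiftedWeight_hC]))
  refine ⟨ModuleCat.ofHom { k with map_smul' := hlin }, ModuleCat.hom_ext
    (ind_hom_ext φ V fun v => ?_)⟩
  rw [parabolicInd_map_indMk]
  exact hk v

/-- Parabolic induction is an equivalence onto the block, with quasi-inverse the weight space
functor. -/
theorem IsSeriesRing.blockEquivalence {X : ObjectProperty (ModuleCat.{0} U)}
    (hX : ∀ M : ModuleCat.{0} U, X M ↔
      thickO M ∧ (y = 0 → ⨆ b : ℂ, (act M h).eigenspace b = ⊤))
    {μ : Weight} (hμ : μ hBarC ≠ 0) : BlockEquivalence X μ R x y := by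
  let φ := shiftedWeight μ x y
  let G : (finDim R).FullSubcategory ⥤ ModuleCat.{0} U := (finDim R).ι ⋙ parabolicInd φ
  have hG : ∀ V, block X μ (G.obj V) := fun V => hR.block_ind hX hμ V.obj V.property
  have : G.Full := ⟨fun {V W} g => by
    obtain ⟨k, hk⟩ := hR.exists_map_eq μ V.obj W.obj V.property W.property g
    exact ⟨ObjectProperty.homMk k, hk⟩⟩
  have : G.Faithful := ⟨fun {V W} k k' hkk => by
    refine ObjectProperty.hom_ext _ (ModuleCat.hom_ext (LinearMap.ext fun v => ?_))
    refine indMk_injective φ W.obj ?_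
    have := congrArg (fun m => m.hom (indMk φ V.obj v)) hkk
    exact this⟩
  let F := (block X μ).lift G hG
  have : F.EssSurj := ⟨fun M => by
    obtain ⟨V, hV, ⟨E⟩⟩ := hR.exists_ind_equiv hX hμ M.obj M.property
    exact ⟨⟨V, hV⟩, ⟨(block X μ).ι.preimageIso (LinearEquiv.toModuleIso E)⟩⟩⟩
  have : F.IsEquivalence := {}
  -- The quasi-inverse of `F` is the weight space functor as soon as `F` followed by the weight
  -- space functor is the forgetful functor.
  choose E hE using fun V : (finDim R).FullSubcategory =>
    exists_weightSpace_equiv μ x y V.obj (hR.hasWeight μ V.obj V.property)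
      (hR.nilpotent_x V.obj V.property) (hR.nilpotent_y V.obj V.property)
  let η : (finDim R).ι ⋙ ModuleCat.restrictScalars (cartanHom φ).toRingHom ≅
      G ⋙ weightFunctor μ :=
    NatIso.ofComponents (fun V => LinearEquiv.toModuleIso (E V)) (fun {V W} k => by
      refine ModuleCat.hom_ext (LinearMap.ext fun v => Subtype.ext ?_)
      refine (hE W _).trans ?_
      refine Eq.trans ?_ (congrArg ((parabolicInd φ).map k.hom).hom (hE V v)).symm
      rfl)
  refine ⟨F.asEquivalence.symm, ⟨?_⟩, ⟨(block X μ).liftCompιIso G hG⟩⟩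
  exact (Functor.isoWhiskerLeft F.inv η) ≪≫
    Functor.isoWhiskerRight F.asEquivalence.counitIso ((block X μ).ι ⋙ weightFunctor μ)

end Equivalence

end TakiffSl2

end

/-- For `μ(h̄) ≠ 0`, the block of classical category `O` is equivalent to the finite-dimensional
`ℂ⟦x⟧`-modules, and the block of thick category `O` to the finite-dimensional `ℂ⟦x, y⟧`-modules, by
the generalized weight space functor and parabolic induction. -/
theorem theorem15 (μ : TakiffSl2.Weight) (hμ : μ TakiffSl2.hBarC ≠ 0) :
    TakiffSl2.BlockEquivalence TakiffSl2.classicalO μ (PowerSeries ℂ) PowerSeries.X 0 ∧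
    TakiffSl2.BlockEquivalence TakiffSl2.thickO μ (MvPowerSeries (Fin 2) ℂ)
      (MvPowerSeries.X 0) (MvPowerSeries.X 1) := by
  refine ⟨TakiffSl2.isSeriesRing_powerSeries.blockEquivalence (fun M => ?_) hμ,
    TakiffSl2.isSeriesRing_mvPowerSeries.blockEquivalence (fun M => ?_) hμ⟩
  · exact and_congr_right fun _ => ⟨fun hM _ => hM, fun hM => hM rfl⟩
  · exact ⟨fun hM => ⟨hM, fun h0 => by
      have := congrArg (MvPowerSeries.coeff (Finsupp.single 1 1)) h0
      simp at this⟩, fun hM => hM.1⟩
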